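/- Theorem (ZFC). The Proper Forcing Axiom (PFA) implies the Mapping Reflection Principle (MRP). The notions involved are as follows. For a cardinal $\theta$, $H(\theta)$ is the set of all sets whose transitive closure has cardinality less than $\theta$. Elementary submodels of $H(\theta)$ are elementary submodels of $(H(\theta),\in,\triangleleft)$, where $\triangleleft$ is a well order of $H(\theta)$ (arbitrary, both in PFA and in MRP). For a set $X$, $[X]^\omega$ is the set of all countable subsets of $X$. A set $E\subseteq[X]^\omega$ is a club if it is cofinal in $([X]^\omega,\subseteq)$ and closed under unions of increasing $\omega$-sequences. A subset of $[X]^\omega$ is open if it is open in the Ellentuck topology, which is generated by the sets $[x,N]=\{Y\in[X]^\omega: x\subseteq Y\subseteq N\}$ for $N\in[X]^\omega$ and finite $x\subseteq N$. PFA. A forcing notion is a nonempty preordered set $\mathcal P$, where $p\le q$ says that $p$ extends $q$. Replacing $\mathcal P$ by an isomorphic copy, one may assume $\mathcal P\in H(|2^{\mathcal P}|^+)$ (where $\aleph_1$ takes the place of $|2^{\mathcal P}|^+$ if $\mathcal P$ is finite). $\mathcal P$ is proper if whenever $M$ is a countable elementary submodel of $H(|2^{\mathcal P}|^+)$ with $\mathcal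 P\in M$ and $p\in\mathcal P\cap M$, there is an $(M,\mathcal P)$-generic $\bar p\le p$, that is, a $\bar p \leq p$ such that for every $r\le\bar p$ and every predense $D\subseteq\mathcal P$ with $D\in M$ some $s\in D\cap M$ is compatible with $r$. PFA says: if $\mathcal P$ is a proper forcing notion and $\mathcal D$ is a family of at most $\aleph_1$ dense subsets of $\mathcal P$, then there is a filter $G\subseteq\mathcal P$ which meets every element of $\mathcal D$. MRP. If $X$ is uncountable and $M$ is a countable elementary submodel of $H(\theta)$ with $\theta$ regular and $[X]^\omega\in M$, then a set $S\subseteq[X]^\omega$ is $M$-stationary if for every club $E\subseteq[X]^\omega$ with $E\in M$ there is an $N\in E\cap S\cap M$. A set mapping $\Sigma$ is open stationary if there are an uncountable set $X=X_\Sigma$ and a regular cardinal $\theta=\theta_\Sigma$ with $X\in H(\theta)$ such that every $M\in\operatorname{dom}(\Sigma)$ is a countable elementary submodel of $H(\theta)$ with $X,[X]^\omega\in M$, and $\Sigma(M)\subseteq[X]^\omega$ is open and $M$-stationary. MRP says: if $\Sigma$ is an open stationary set mapping whose domain is a club in $[H(\theta_\Sigma)]^\omega$, then there is a sequence $\langle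 N_\nu:\nu<\omega_1\rangle$ of elements of $\operatorname{dom}(\Sigma)$ with $N_\xi\in N_\nu$ for all $\xi<\nu<\omega_1$ and $N_\nu=\bigcup_{\xi<\nu}N_\xi$ for all limit $0<\nu<\omega_1$ (a continuous $\in$-chain) such that for every limit $0<\nu<\omega_1$ there is a $\nu_0<\nu$ with $N_\xi\cap X_\Sigma\in\Sigma(N_\nu)$ whenever $\nu_0<\xi<\nu$. -/

import Mathlib

universe u

namespace MappingReflection

open Cardinal Ordinal FirstOrder

/-! ### The structures `(H(θ), ∈, ◁)` and their countable elementary submodels -/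

/-- A transitive set of cardinality `< θ` has rank `< θ` (needed for `mem_H` only). -/
theorem rank_lt_ord_of_isTransitive {t : ZFSet.{u}} {θ : Cardinal.{u}} (ht : t.IsTransitive)
    (hc : t.card < θ) : t.rank < θ.ord := by
  have key : ∀ a < t.rank, ∃ y ∈ t, y.rank = a := by
    intro a ha
    obtain ⟨y₀, hy₀, hle₀⟩ := ZFSet.lt_rank_iff.1 ha
    induction y₀ using ZFSet.inductionOn with
    | _ y ih =>
      rcases hle₀.eq_or_lt with h | h
      · exact ⟨y, hy₀, h.symm⟩
      · obtain ⟨z, hz, hle⟩ := ZFSet.lt_rank_iff.1 h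
        exact ih z hz (ht.mem_trans hz hy₀) hle
  rw [Cardinal.lt_ord]
  refine lt_of_le_of_lt ?_ hc
  rw [← Cardinal.lift_le.{u + 1}, ← ZFSet.cardinalMk_coe_sort, ← Cardinal.mk_Iio_ordinal]
  let f : t → Set.Iio t.rank := fun y => ⟨(y : ZFSet).rank, ZFSet.rank_lt_of_mem y.2⟩
  refine Cardinal.mk_le_of_surjective (f := f) ?_
  rintro ⟨a, ha⟩
  obtain ⟨y, hy, rfl⟩ := key a ha
  exact ⟨⟨y, hy⟩, rfl⟩

/-- `H(θ)`: the sets of hereditary cardinality less than `θ`, that is, the sets whose transitive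
closure has fewer than `θ` elements.  It is carved out of `V_θ`; see `mem_H`. -/
noncomputable def H (θ : Cardinal.{u}) : ZFSet.{u} :=
  ZFSet.sep (fun x => ∃ t : ZFSet.{u}, t.IsTransitive ∧ x ⊆ t ∧ t.card < θ)
    (ZFSet.vonNeumann θ.ord)

theorem mem_H {θ : Cardinal.{u}} {x : ZFSet.{u}} :
    x ∈ H θ ↔ ∃ t : ZFSet.{u}, t.IsTransitive ∧ x ⊆ t ∧ t.card < θ := by
  rw [H, ZFSet.mem_sep, and_iff_right_iff_imp]
  rintro ⟨t, ht, hxt, hc⟩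
  rw [ZFSet.mem_vonNeumann]
  exact (ZFSet.rank_mono hxt).trans_lt (rank_lt_ord_of_isTransitive ht hc)

/-- The two binary relation symbols `∈` and `◁`. -/
inductive SetRel : ℕ → Type
  | mem : SetRel 2
  | tri : SetRel 2

/-- The first-order language with the relation symbols `∈` and `◁` and no function symbols. -/
def setLang : FirstOrder.Language := ⟨fun _ => Empty, SetRel⟩

/-- The structure `(H(θ), ∈, ◁)`. -/
@[reducible] def hStructure (θ : Cardinal.{u}) (tri : H θ → H θ → Prop) :
    setLang.Structure (H θ) where
  funMap := fun f _ => nomatch f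
  RelMap := fun R v =>
    match R, v with
    | SetRel.mem, v => (v 0 : ZFSet.{u}) ∈ (v 1 : ZFSet.{u})
    | SetRel.tri, v => tri (v 0) (v 1)

/-- `[X]^ω`: the set of all countable subsets of `X`. -/
noncomputable def ctbl (X : ZFSet.{u}) : ZFSet.{u} :=
  ZFSet.sep (fun Y => (Y : Set ZFSet.{u}).Countable) X.powerset

/-- `M` is a countable elementary submodel of `(H(θ), ∈, ◁)`. -/
def IsCtblElementary (θ : Cardinal.{u}) (tri : H θ → H θ → Prop) (M : ZFSet.{u}) : Prop :=
  letI := hStructure θ tri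
  M ∈ ctbl (H θ) ∧
    ∃ S : setLang.ElementarySubstructure (H θ), ∀ x : H θ, x ∈ S ↔ (x : ZFSet.{u}) ∈ M

/-! ### The Proper Forcing Axiom -/

/-- A forcing notion: a nonempty set `carrier` with a reflexive and transitive relation `rel`
(a set of ordered pairs); `pair p q ∈ rel` says that `p ≤ q`, i.e. that `p` extends `q`. -/
structure ForcingNotion where
  carrier : ZFSet.{u}
  rel : ZFSet.{u}
  nonempty : carrier.Nonempty
  rel_subset : rel ⊆ carrier.prod carrier
  refl : ∀ p ∈ carrier, ZFSet.pair p p ∈ rel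
  trans : ∀ p q r, ZFSet.pair p q ∈ rel → ZFSet.pair q r ∈ rel → ZFSet.pair p r ∈ rel

namespace ForcingNotion

variable (P : ForcingNotion.{u})

/-- `p ≤ q`: the condition `p` extends the condition `q`. -/
def le (p q : ZFSet.{u}) : Prop := ZFSet.pair p q ∈ P.rel

/-- The forcing notion as one set, the ordered pair `(carrier, rel)`. -/
def code : ZFSet.{u} := ZFSet.pair P.carrier P.rel

/-- Two conditions are compatible if they have a common extension. -/
def Compatible (p q : ZFSet.{u}) : Prop := ∃ r, P.le r p ∧ P.le r q

def IsDense (D : ZFSet.{u}) : Prop :=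
  D ⊆ P.carrier ∧ ∀ p ∈ P.carrier, ∃ d ∈ D, P.le d p

def IsPredense (D : ZFSet.{u}) : Prop :=
  D ⊆ P.carrier ∧ ∀ p ∈ P.carrier, ∃ d ∈ D, P.Compatible d p

structure IsFilter (G : Set ZFSet.{u}) : Prop where
  subset : ∀ p ∈ G, p ∈ P.carrier
  nonempty : G.Nonempty
  upward : ∀ p ∈ G, ∀ q, P.le p q → q ∈ G
  directed : ∀ p ∈ G, ∀ q ∈ G, ∃ r ∈ G, P.le r p ∧ P.le r q

/-- The cardinal `|2^P|⁺` (with `ℵ₁` in its place when `P` is finite). -/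
noncomputable def properCard : Cardinal.{u} := Order.succ (max ℵ₀ (2 ^ P.carrier.card))

/-- `p'` is `(M, P)`-generic: if `r` extends `p'` and `D ∈ M` is predense in `P`, then some
`s ∈ D ∩ M` is compatible with `r`. -/
def IsGenericCondition (M p' : ZFSet.{u}) : Prop :=
  ∀ r, P.le r p' → ∀ D ∈ M, P.IsPredense D → ∃ s ∈ D, s ∈ M ∧ P.Compatible s r

/-- `P` is proper: whenever `M` is a countable elementary submodel of `H(|2^P|⁺)` containing `P`
and `p ∈ P ∩ M`, some `p' ≤ p` is `(M, P)`-generic. -/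
def IsProper : Prop :=
  ∀ tri : H P.properCard → H P.properCard → Prop, IsWellOrder (H P.properCard) tri →
    ∀ M : ZFSet.{u}, IsCtblElementary P.properCard tri M → P.code ∈ M →
      ∀ p ∈ P.carrier, p ∈ M → ∃ p', P.le p' p ∧ P.IsGenericCondition M p'

end ForcingNotion

/-- The Proper Forcing Axiom.  The requirement `P ∈ H(|2^P|⁺)` is what the definition of properness
through elementary submodels of `H(|2^P|⁺)` presupposes; each forcing notion is isomorphic to one
that satisfies it (for instance to one whose underlying set is a cardinal). -/
def PFA : Prop :=
  ∀ P : ForcingNotion.{u}, P.code ∈ H P.properCard → P.IsProper →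
    ∀ 𝒟 : Set ZFSet.{u}, #𝒟 ≤ ℵ₁ → (∀ D ∈ 𝒟, P.IsDense D) →
      ∃ G : Set ZFSet.{u}, P.IsFilter G ∧ ∀ D ∈ 𝒟, ∃ p ∈ G, p ∈ D

/-! ### The Mapping Reflection Principle -/

/-- `E` is a club in `[X]^ω`: cofinal, and closed under unions of increasing `ω`-chains. -/
structure IsClub (X E : ZFSet.{u}) : Prop where
  subset : E ⊆ ctbl X
  cofinal : ∀ Y ∈ ctbl X, ∃ Z ∈ E, Y ⊆ Z
  closed : ∀ f : ℕ → ZFSet.{u}, (∀ n, f n ∈ E) → (∀ n, f n ⊆ f (n + 1)) → ZFSet.iUnion f ∈ E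

/-- The Ellentuck topology on `[X]^ω`, generated by the sets `[x, N] = {Y | x ⊆ Y ⊆ N}` with
`N ∈ [X]^ω` and `x ⊆ N` finite. -/
@[reducible] def ellentuck (X : ZFSet.{u}) : TopologicalSpace (ctbl X) :=
  TopologicalSpace.generateFrom
    {U | ∃ (N : ctbl X) (x : Set ZFSet.{u}), x.Finite ∧ x ⊆ ((N : ZFSet.{u}) : Set ZFSet.{u}) ∧
      U = {Y : ctbl X | x ⊆ ((Y : ZFSet.{u}) : Set ZFSet.{u}) ∧ (Y : ZFSet.{u}) ⊆ (N : ZFSet.{u})}}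

/-- `S ⊆ [X]^ω` is open in the Ellentuck topology. -/
def IsEllentuckOpen (X S : ZFSet.{u}) : Prop :=
  S ⊆ ctbl X ∧ @IsOpen _ (ellentuck X) {Y : ctbl X | (Y : ZFSet.{u}) ∈ S}

/-- `S ⊆ [X]^ω` is `M`-stationary: each club `E ⊆ [X]^ω` with `E ∈ M` meets `S ∩ M`. -/
def IsStationaryFor (X M S : ZFSet.{u}) : Prop :=
  S ⊆ ctbl X ∧ ∀ E ∈ M, IsClub X E → ∃ N, N ∈ E ∧ N ∈ S ∧ N ∈ M

/-- An open stationary set mapping `Σ` with `X = X_Σ` and `θ = θ_Σ`.  Here `dom` is the domain of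
`Σ`; the values of `map` outside `dom` play no role. -/
structure OpenStationaryMap where
  X : ZFSet.{u}
  θ : Cardinal.{u}
  tri : H θ → H θ → Prop
  dom : ZFSet.{u}
  map : ZFSet.{u} → ZFSet.{u}
  uncountable : ¬ (X : Set ZFSet.{u}).Countable
  regular : θ.IsRegular
  mem_H : X ∈ H θ
  wellOrder : IsWellOrder (H θ) tri
  elementary : ∀ M ∈ dom, IsCtblElementary θ tri M
  base_mem : ∀ M ∈ dom, X ∈ M
  ctbl_mem : ∀ M ∈ dom, ctbl X ∈ M
  isOpen : ∀ M ∈ dom, IsEllentuckOpen X (map M)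
  stationary : ∀ M ∈ dom, IsStationaryFor X M (map M)

/-- `⟨N ν : ν < ω₁⟩` is a continuous `∈`-chain. -/
def IsContinuousChain (N : Ordinal.{u} → ZFSet.{u}) : Prop :=
  (∀ ξ ν, ξ < ν → ν < ω₁ → N ξ ∈ N ν) ∧
    ∀ ν, ν < ω₁ → Order.IsSuccLimit ν → ∀ x, x ∈ N ν ↔ ∃ ξ < ν, x ∈ N ξ

/-- `⟨N ν : ν < ω₁⟩` reflects `Σ`: for each limit `0 < ν < ω₁` there is `ν₀ < ν` with
`N ξ ∩ X ∈ Σ (N ν)` whenever `ν₀ < ξ < ν`. -/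
def Reflects (S : OpenStationaryMap.{u}) (N : Ordinal.{u} → ZFSet.{u}) : Prop :=
  ∀ ν, ν < ω₁ → Order.IsSuccLimit ν →
    ∃ ν₀ < ν, ∀ ξ, ν₀ < ξ → ξ < ν → N ξ ∩ S.X ∈ S.map (N ν)

/-- The Mapping Reflection Principle. -/
def MRP : Prop :=
  ∀ S : OpenStationaryMap.{u}, IsClub (H S.θ) S.dom →
    ∃ N : Ordinal.{u} → ZFSet.{u},
      (∀ ν < ω₁, N ν ∈ S.dom) ∧ IsContinuousChain N ∧ Reflects S N

end MappingReflection

namespace MappingReflection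

open Cardinal Ordinal FirstOrder

/-! ### Closure properties of `H(θ)` -/

/-! Force with countable continuous ∈-chains of models, of successor length, that reflect Σ at their
limit indices, ordered by end-extension. The models are good: they lie in the domain of Σ and
include each of their countable elements, so membership between them gives inclusion. Every element
of `H(θ)` enters the top model of some extension. A filter that does this for ℵ₁ points of X
contains chains of every countable length, since otherwise countably many countable models would
cover these points; by directedness its chains glue to the required sequence. What remains is
properness.

Let M be a countable, sufficiently closed set. Then K = M ∩ `H(θ)` is the union of an increasing
ω-sequence of good models, hence good, and Σ(K) is open and K-stationary. Build a descending
sequence of conditions in M that passes below a member of each predense set in M, and put K on top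
of its limit. The one obstacle is reflection at K: the traces on X of the new models must lie in
Σ(K). For a condition c and a predense D in M, `Cond.clubSet` consists of the countable Y ⊆ X such
that for each finite x ⊆ Y some proper extension of c lies below a member of D and has new models
that contain x and have traces inside Y. It is a club and an element of K, so it has a member Y ∈
Σ(K) ∩ K. Openness gives a finite x ⊆ Y with [x, Y] ⊆ Σ(K), and closure of M gives a witness for x
and Y inside M. This is `IsSuitable.exists_step`.

To avoid definability arguments, `PFA.exists_filter` pads every condition with a code of countably
many functions. A countable elementary submodel that contains a padded condition is then closed
under these functions. So properness has to be checked only for countable sets closed under pairing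
and under functions chosen in advance, here Skolem functions for the argument above. -/

theorem H_isTransitive (θ : Cardinal.{u}) : (H θ).IsTransitive := by
  intro x hx y hy
  obtain ⟨t, ht, hxt, hc⟩ := mem_H.1 hx
  exact mem_H.2 ⟨t, ht, ht _ (hxt hy), hc⟩

theorem mem_H_of_subset {θ : Cardinal.{u}} {x y : ZFSet.{u}} (hx : x ∈ H θ) (h : y ⊆ x) :
    y ∈ H θ := by
  obtain ⟨t, ht, hxt, hc⟩ := mem_H.1 hx
  exact mem_H.2 ⟨t, ht, fun _ hz => hxt (h hz), hc⟩

theorem mem_H_of_subset_transitive {θ : Cardinal.{u}} {t x : ZFSet.{u}} (ht : t.IsTransitive)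
    (hc : t.card < θ) (h : x ⊆ t) : x ∈ H θ :=
  mem_H.2 ⟨t, ht, h, hc⟩

theorem unordered_pair_mem_H {θ : Cardinal.{u}} (hθ : ℵ₀ ≤ θ) {x y : ZFSet.{u}} (hx : x ∈ H θ)
    (hy : y ∈ H θ) : ({x, y} : ZFSet) ∈ H θ := by
  obtain ⟨t, ht, hxt, hc⟩ := mem_H.1 hx
  obtain ⟨s, hs, hys, hd⟩ := mem_H.1 hy
  refine mem_H.2 ⟨insert x (insert y (t ∪ s)), ?_, ?_, ?_⟩
  · intro z hz w hw
    simp only [ZFSet.mem_insert_iff, ZFSet.mem_union] at hz ⊢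
    right; right
    rcases hz with rfl | rfl | hz | hz
    · exact Or.inl (hxt hw)
    · exact Or.inr (hys hw)
    · exact Or.inl (ht _ hz hw)
    · exact Or.inr (hs _ hz hw)
  · intro z hz
    simp only [ZFSet.mem_pair] at hz
    rcases hz with rfl | rfl <;> simp
  · have h1 : (1 : Cardinal.{u}) < θ := one_lt_aleph0.trans_le hθ
    refine ZFSet.card_insert_le.trans_lt (add_lt_of_lt hθ ?_ h1)
    refine ZFSet.card_insert_le.trans_lt (add_lt_of_lt hθ ?_ h1)
    exact ZFSet.card_union_le.trans_lt (add_lt_of_lt hθ hc hd)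

theorem pair_mem_H {θ : Cardinal.{u}} (hθ : ℵ₀ ≤ θ) {x y : ZFSet.{u}} (hx : x ∈ H θ)
    (hy : y ∈ H θ) : ZFSet.pair x y ∈ H θ := by
  refine unordered_pair_mem_H hθ ?_ (unordered_pair_mem_H hθ hx hy)
  have := unordered_pair_mem_H hθ hx hx
  rwa [ZFSet.pair_eq_singleton] at this

theorem pair_mem_transitive {t x y : ZFSet.{u}} (ht : t.IsTransitive) (h : ZFSet.pair x y ∈ t) :
    x ∈ t ∧ y ∈ t := by
  have h2 : ({x, y} : ZFSet) ∈ t := ht _ h (by simp [ZFSet.pair])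
  exact ⟨ht _ h2 (by simp), ht _ h2 (by simp)⟩

/-- Regularity keeps the union of countably many transitive sets of size `< θ` below `θ`; adding the
countable set `x` itself preserves transitivity. -/
theorem countable_subset_mem_H {θ : Cardinal.{u}} (hθ : θ.IsRegular) (h : ℵ₀ < θ)
    {x : ZFSet.{u}} (hx : x ∈ ctbl (H θ)) : x ∈ H θ := by
  rw [ctbl, ZFSet.mem_sep, ZFSet.mem_powerset] at hx
  obtain ⟨hs, hc⟩ := hx
  have key : ∀ y : x, ∃ t : ZFSet.{u}, t.IsTransitive ∧ (y : ZFSet) ⊆ t ∧ t.card < θ :=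
    fun y => mem_H.1 (hs y.2)
  choose t ht hyt hct using key
  have hcx : x.card ≤ ℵ₀ := by
    rw [← Cardinal.lift_le.{u + 1}, ← ZFSet.cardinalMk_coe_sort, Cardinal.lift_aleph0]
    exact Cardinal.mk_le_aleph0_iff.2 hc
  have hU : (ZFSet.iUnion fun i : Shrink x => t ((equivShrink x).symm i)).card < θ := by
    have := ZFSet.lift_card_iUnion_le_sum_card
      (f := fun i : Shrink.{u} x => t ((equivShrink x).symm i))
    rw [Cardinal.lift_id] at this
    refine this.trans_lt (sum_lt_of_isRegular hθ (hcx.trans_lt h) fun i => hct _)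
  refine mem_H_of_subset_transitive
    (t := x ∪ ZFSet.iUnion fun i : Shrink x => t ((equivShrink x).symm i)) ?_ ?_ ?_
  · intro y hy z hz
    simp only [ZFSet.mem_union, ZFSet.mem_iUnion] at hy ⊢
    right
    rcases hy with hy | ⟨i, hi⟩
    · exact ⟨equivShrink x ⟨y, hy⟩, by simpa using hyt ⟨y, hy⟩ hz⟩
    · exact ⟨i, ht _ _ hi hz⟩
  · exact ZFSet.card_union_le.trans_lt (add_lt_of_lt h.le (hcx.trans_lt h) hU)
  · intro y hy
    simp [hy]

/-! ### First-order closure of elementary submodels -/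

open FirstOrder.Language in
/-- The formula `x ∈ y`. -/
def memF {α : Type} {n : ℕ} (x y : α ⊕ Fin n) : setLang.BoundedFormula α n :=
  Relations.boundedFormula₂ (L := setLang) (SetRel.mem : setLang.Relations 2)
    (Term.var x) (Term.var y)

open FirstOrder.Language in
/-- The formula `x = y`. -/
def eqF {α : Type} {n : ℕ} (x y : α ⊕ Fin n) : setLang.BoundedFormula α n :=
  Term.bdEqual (L := setLang) (Term.var x) (Term.var y)

/-- Weakening of a variable by one bound variable. -/
def wk {α : Type} {n : ℕ} (x : α ⊕ Fin n) : α ⊕ Fin (n + 1) := Sum.map id Fin.castSucc x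

/-- The innermost bound variable. -/
def bv {α : Type} (n : ℕ) : α ⊕ Fin (n + 1) := Sum.inr (Fin.last n)

/-- The formula `y = {a, b}`. -/
def upairF {α : Type} {n : ℕ} (y a b : α ⊕ Fin n) : setLang.BoundedFormula α n :=
  ((memF (bv n) (wk y)).iff (eqF (bv n) (wk a) ⊔ eqF (bv n) (wk b))).all

/-- The formula `y = (a, b)`. -/
def pairF {α : Type} {n : ℕ} (y a b : α ⊕ Fin n) : setLang.BoundedFormula α n :=
  ((memF (bv n) (wk y)).iff
    (upairF (bv n) (wk a) (wk a) ⊔ upairF (bv n) (wk a) (wk b))).all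

section Realize

variable {θ : Cardinal.{u}} {tri : H θ → H θ → Prop} {α : Type} {n : ℕ}
  {v : α → H θ} {xs : Fin n → H θ}

theorem elim_wk (x : α ⊕ Fin n) (a : H θ) :
    Sum.elim v (Fin.snoc xs a : Fin (n + 1) → H θ) (wk x) = Sum.elim v xs x := by
  cases x <;> simp [wk]

theorem elim_bv (a : H θ) :
    Sum.elim v (Fin.snoc xs a : Fin (n + 1) → H θ) (bv n) = a := by
  simp [bv]

theorem realize_memF (x y : α ⊕ Fin n) :
    letI := hStructure θ tri
    (memF x y).Realize v xs ↔ ((Sum.elim v xs x : H θ) : ZFSet.{u}) ∈ ((Sum.elim v xs y : H θ) : ZFSet.{u}) := by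
  simp only [memF]
  rfl

theorem realize_eqF (x y : α ⊕ Fin n) :
    letI := hStructure θ tri
    (eqF x y).Realize v xs ↔ ((Sum.elim v xs x : H θ) : ZFSet.{u}) = ((Sum.elim v xs y : H θ) : ZFSet.{u}) := by
  simp only [eqF, FirstOrder.Language.BoundedFormula.realize_bdEqual, Subtype.ext_iff]
  rfl

/-- Since `H θ` is transitive, quantifiers over `H θ` decide true equality, so the formulas for
pairs mean in `H θ` what they should. -/
theorem ext_H {x y : ZFSet.{u}} (hx : x ∈ H θ) (hy : y ⊆ H θ) :
    x = y ↔ ∀ z : H θ, (z : ZFSet.{u}) ∈ x ↔ (z : ZFSet.{u}) ∈ y := by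
  refine ⟨fun h => by simp [h], fun h => ZFSet.ext fun z => ⟨fun hz => ?_, fun hz => ?_⟩⟩
  · exact (h ⟨z, H_isTransitive θ _ hx hz⟩).1 hz
  · exact (h ⟨z, hy hz⟩).2 hz

theorem realize_upairF (y a b : α ⊕ Fin n) :
    letI := hStructure θ tri
    (upairF y a b).Realize v xs ↔ ((Sum.elim v xs y : H θ) : ZFSet.{u}) =
      {((Sum.elim v xs a : H θ) : ZFSet.{u}), ((Sum.elim v xs b : H θ) : ZFSet.{u})} := by
  rw [ext_H (Sum.elim v xs y : H θ).2 (by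
    intro z hz
    rcases ZFSet.mem_pair.1 hz with rfl | rfl
    exacts [(Sum.elim v xs a : H θ).2, (Sum.elim v xs b : H θ).2])]
  simp only [upairF, FirstOrder.Language.BoundedFormula.realize_all,
    FirstOrder.Language.BoundedFormula.realize_iff,
    FirstOrder.Language.BoundedFormula.realize_sup, realize_memF, realize_eqF, elim_wk, elim_bv,
    ZFSet.mem_pair]

theorem realize_pairF (hθ : ℵ₀ ≤ θ) (y a b : α ⊕ Fin n) :
    letI := hStructure θ tri
    (pairF y a b).Realize v xs ↔ ((Sum.elim v xs y : H θ) : ZFSet.{u}) =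
      ZFSet.pair ((Sum.elim v xs a : H θ) : ZFSet.{u}) ((Sum.elim v xs b : H θ) : ZFSet.{u}) := by
  rw [ext_H (Sum.elim v xs y : H θ).2
    (H_isTransitive θ _ (pair_mem_H hθ (Sum.elim v xs a : H θ).2 (Sum.elim v xs b : H θ).2))]
  simp only [pairF, FirstOrder.Language.BoundedFormula.realize_all,
    FirstOrder.Language.BoundedFormula.realize_iff,
    FirstOrder.Language.BoundedFormula.realize_sup, realize_memF, realize_upairF, elim_wk, elim_bv,
    ZFSet.pair, ZFSet.mem_pair, ZFSet.pair_eq_singleton]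

end Realize

/-- Elementarity in Tarski–Vaught form, the only form in which it is used. -/
theorem IsCtblElementary.exists_mem {θ : Cardinal.{u}} {tri : H θ → H θ → Prop} {M : ZFSet.{u}}
    (hM : IsCtblElementary θ tri M) {α : Type} (φ : setLang.BoundedFormula α 1) (v : α → H θ)
    (hv : ∀ i, (v i : ZFSet.{u}) ∈ M)
    (hex : letI := hStructure θ tri; ∃ y : H θ, φ.Realize v (Fin.snoc default y)) :
    letI := hStructure θ tri
    ∃ y : H θ, (y : ZFSet.{u}) ∈ M ∧ φ.Realize v (Fin.snoc default y) := by
  let := hStructure θ tri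
  obtain ⟨-, S, hS⟩ := hM
  let w : α → S := fun i => ⟨v i, (hS _).2 (hv i)⟩
  have h1 : φ.ex.Realize (S.subtype ∘ w) (S.subtype ∘ default) := by
    rw [FirstOrder.Language.BoundedFormula.realize_ex]
    obtain ⟨y, hy⟩ := hex
    refine ⟨y, ?_⟩
    convert! hy
  rw [S.subtype.map_boundedFormula, FirstOrder.Language.BoundedFormula.realize_ex] at h1
  obtain ⟨y, hy⟩ := h1
  refine ⟨y, (hS _).1 y.2, ?_⟩
  rw [← S.subtype.map_boundedFormula] at hy
  convert! hy using 1

/-- The closure properties of elementary submodels of `H(θ)` used below. -/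
structure IsClosedModel (M : ZFSet.{u}) : Prop where
  pair : ∀ a ∈ M, ∀ b ∈ M, ZFSet.pair a b ∈ M
  left : ∀ a b, ZFSet.pair a b ∈ M → a ∈ M
  right : ∀ a b, ZFSet.pair a b ∈ M → b ∈ M
  mem : ∀ a ∈ M, a.Nonempty → ∃ z ∈ a, z ∈ M
  fibre : ∀ R ∈ M, ∀ a ∈ M, ∃ y ∈ M, ∀ z, z ∈ y ↔ ZFSet.pair a z ∈ R
  domain : ∀ R ∈ M, ∃ y ∈ M, ∀ z, z ∈ y ↔ ∃ b, ZFSet.pair z b ∈ R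

/-- In each clause but `mem` the desired set is the unique solution in `H θ` of a formula with
parameters in `M`, so the solution found in `M` is that set. Fibres and domains are in `H θ` because
a transitive set that includes the relation includes them. -/
theorem IsCtblElementary.isClosedModel {θ : Cardinal.{u}} (hθ : ℵ₀ ≤ θ)
    {tri : H θ → H θ → Prop} {M : ZFSet.{u}} (hM : IsCtblElementary θ tri M) :
    IsClosedModel M := by
  let := hStructure θ tri
  have hMH : ∀ a ∈ M, a ∈ H θ := by
    have := hM.1
    rw [ctbl, ZFSet.mem_sep, ZFSet.mem_powerset] at this
    exact fun a ha => this.1 ha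
  have hvar (y : H θ) (i : Fin 1) : (Fin.snoc default y : Fin 1 → H θ) i = y := by
    fin_cases i; rfl
  refine ⟨fun a ha b hb => ?_, fun a b hab => ?_, fun a b hab => ?_, fun a ha hne => ?_,
    fun R hR a ha => ?_, fun R hR => ?_⟩
  · obtain ⟨y, hy, h⟩ := hM.exists_mem (α := Fin 2) (pairF (Sum.inr 0) (Sum.inl 0) (Sum.inl 1))
      ![⟨a, hMH a ha⟩, ⟨b, hMH b hb⟩] (by simp [Fin.forall_fin_two, ha, hb])
      ⟨⟨_, pair_mem_H hθ (hMH a ha) (hMH b hb)⟩, by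
        rw [realize_pairF hθ]; simp [hvar]⟩
    rw [realize_pairF hθ] at h
    simp only [Sum.elim_inr, Sum.elim_inl, hvar] at h
    rw [h] at hy
    exact hy
  · have hab' := pair_mem_transitive (H_isTransitive θ) (hMH _ hab)
    obtain ⟨y, hy, h⟩ := hM.exists_mem (α := Unit)
      (pairF (n := 2) (Sum.inl ()) (Sum.inr 0) (Sum.inr 1)).ex
      (fun _ => ⟨_, hMH _ hab⟩) (by simpa using hab)
      ⟨⟨a, hab'.1⟩, by
        rw [FirstOrder.Language.BoundedFormula.realize_ex]
        refine ⟨⟨b, hab'.2⟩, ?_⟩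
        rw [realize_pairF hθ]; rfl⟩
    rw [FirstOrder.Language.BoundedFormula.realize_ex] at h
    obtain ⟨z, h⟩ := h
    rw [realize_pairF hθ] at h
    have h' : ZFSet.pair a b = ZFSet.pair y z := h
    rw [(ZFSet.pair_inj.1 h').1]
    exact hy
  · have hab' := pair_mem_transitive (H_isTransitive θ) (hMH _ hab)
    obtain ⟨y, hy, h⟩ := hM.exists_mem (α := Unit)
      (pairF (n := 2) (Sum.inl ()) (Sum.inr 1) (Sum.inr 0)).ex
      (fun _ => ⟨_, hMH _ hab⟩) (by simpa using hab)
      ⟨⟨b, hab'.2⟩, by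
        rw [FirstOrder.Language.BoundedFormula.realize_ex]
        refine ⟨⟨a, hab'.1⟩, ?_⟩
        rw [realize_pairF hθ]; rfl⟩
    rw [FirstOrder.Language.BoundedFormula.realize_ex] at h
    obtain ⟨z, h⟩ := h
    rw [realize_pairF hθ] at h
    have h' : ZFSet.pair a b = ZFSet.pair z y := h
    rw [(ZFSet.pair_inj.1 h').2]
    exact hy
  · obtain ⟨z, hz⟩ := hne
    obtain ⟨y, hy, h⟩ := hM.exists_mem (α := Unit) (memF (Sum.inr 0) (Sum.inl ()))
      (fun _ => ⟨a, hMH a ha⟩) (by simpa using ha)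
      ⟨⟨z, H_isTransitive θ _ (hMH a ha) hz⟩, by rw [realize_memF]; exact hz⟩
    rw [realize_memF] at h
    exact ⟨y, h, hy⟩
  · obtain ⟨t, ht, hRt, hc⟩ := mem_H.1 (hMH R hR)
    have hfib (z : ZFSet) (hz : ZFSet.pair a z ∈ R) : z ∈ t :=
      (pair_mem_transitive ht (hRt hz)).2
    let Y := ZFSet.sep (fun z => ZFSet.pair a z ∈ R) t
    have hYt : Y ⊆ t := fun z hz => (ZFSet.mem_sep.1 hz).1
    have hY (z : ZFSet) : z ∈ Y ↔ ZFSet.pair a z ∈ R := by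
      rw [ZFSet.mem_sep]; exact ⟨fun h => h.2, fun h => ⟨hfib z h, h⟩⟩
    let φ : setLang.BoundedFormula (Fin 2) 1 := ((memF (n := 2) (Sum.inr 1) (Sum.inr 0)).iff
      (memF (n := 3) (Sum.inr 2) (Sum.inl 0) ⊓
        pairF (n := 3) (Sum.inr 2) (Sum.inl 1) (Sum.inr 1)).ex).all
    have hφ (y : H θ) : φ.Realize ![⟨R, hMH R hR⟩, ⟨a, hMH a ha⟩] (Fin.snoc default y) ↔
        ∀ z : H θ, (z : ZFSet) ∈ (y : ZFSet) ↔ ZFSet.pair a z ∈ R := by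
      simp only [φ, FirstOrder.Language.BoundedFormula.realize_all,
        FirstOrder.Language.BoundedFormula.realize_iff,
        FirstOrder.Language.BoundedFormula.realize_ex,
        FirstOrder.Language.BoundedFormula.realize_inf, realize_memF, realize_pairF hθ]
      refine forall_congr' fun z => iff_congr Iff.rfl ⟨?_, fun h => ?_⟩
      · rintro ⟨w, hw, h⟩
        have hw' : (w : ZFSet) ∈ R := hw
        have h' : (w : ZFSet) = ZFSet.pair a z := h
        rwa [← h']
      · exact ⟨⟨_, H_isTransitive θ _ (hMH R hR) h⟩, h, rfl⟩
    obtain ⟨y, hy, h⟩ := hM.exists_mem φ ![⟨R, hMH R hR⟩, ⟨a, hMH a ha⟩]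
      (by simp [Fin.forall_fin_two, ha, hR])
      ⟨⟨Y, mem_H_of_subset_transitive ht hc hYt⟩, (hφ _).2 fun z => hY z⟩
    rw [hφ] at h
    refine ⟨y, hy, fun z => ⟨fun hz => (h ⟨z, H_isTransitive θ _ y.2 hz⟩).1 hz, fun hz => ?_⟩⟩
    exact (h ⟨z, (pair_mem_transitive (H_isTransitive θ)
      (H_isTransitive θ _ (hMH R hR) hz)).2⟩).2 hz
  · obtain ⟨t, ht, hRt, hc⟩ := mem_H.1 (hMH R hR)
    let Y := ZFSet.sep (fun z => ∃ b, ZFSet.pair z b ∈ R) t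
    have hYt : Y ⊆ t := fun z hz => (ZFSet.mem_sep.1 hz).1
    have hY (z : ZFSet) : z ∈ Y ↔ ∃ b, ZFSet.pair z b ∈ R := by
      rw [ZFSet.mem_sep]
      exact ⟨fun h => h.2, fun ⟨b, h⟩ => ⟨(pair_mem_transitive ht (hRt h)).1, b, h⟩⟩
    let φ : setLang.BoundedFormula Unit 1 := ((memF (n := 2) (Sum.inr 1) (Sum.inr 0)).iff
      (memF (n := 4) (Sum.inr 3) (Sum.inl ()) ⊓
        pairF (n := 4) (Sum.inr 3) (Sum.inr 1) (Sum.inr 2)).ex.ex).all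
    have hφ (y : H θ) : φ.Realize (fun _ => ⟨R, hMH R hR⟩) (Fin.snoc default y) ↔
        ∀ z : H θ, (z : ZFSet) ∈ (y : ZFSet) ↔ ∃ b, ZFSet.pair z b ∈ R := by
      simp only [φ, FirstOrder.Language.BoundedFormula.realize_all,
        FirstOrder.Language.BoundedFormula.realize_iff,
        FirstOrder.Language.BoundedFormula.realize_ex,
        FirstOrder.Language.BoundedFormula.realize_inf, realize_memF, realize_pairF hθ]
      refine forall_congr' fun z => iff_congr Iff.rfl ⟨?_, ?_⟩
      · rintro ⟨b, w, hw, h⟩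
        have hw' : (w : ZFSet) ∈ R := hw
        have h' : (w : ZFSet) = ZFSet.pair z b := h
        exact ⟨b, by rwa [← h']⟩
      · rintro ⟨b, h⟩
        have hp := H_isTransitive θ _ (hMH R hR) h
        exact ⟨⟨b, (pair_mem_transitive (H_isTransitive θ) hp).2⟩, ⟨_, hp⟩, h, rfl⟩
    obtain ⟨y, hy, h⟩ := hM.exists_mem φ (fun _ => ⟨R, hMH R hR⟩) (by simpa using hR)
      ⟨⟨Y, mem_H_of_subset_transitive ht hc hYt⟩, (hφ _).2 fun z => hY z⟩
    rw [hφ] at h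
    refine ⟨y, hy, fun z => ⟨fun hz => (h ⟨z, H_isTransitive θ _ y.2 hz⟩).1 hz, ?_⟩⟩
    rintro ⟨b, hb⟩
    exact (h ⟨z, (pair_mem_transitive (H_isTransitive θ)
      (H_isTransitive θ _ (hMH R hR) hb)).1⟩).2 ⟨b, hb⟩

/-! ### A form of `PFA` for small preorders and closure under prescribed functions -/

/-- A level of the von Neumann hierarchy at a limit above the rank of `a` works. -/
theorem exists_transitive_pair_closed (a : ZFSet.{u}) :
    ∃ W : ZFSet.{u}, W.IsTransitive ∧ a ∈ W ∧ ∀ x ∈ W, ∀ y ∈ W, ZFSet.pair x y ∈ W := by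
  have hlim : Order.IsSuccLimit (a.rank + ω) := isSuccLimit_add _ isSuccLimit_omega0
  refine ⟨ZFSet.vonNeumann (a.rank + ω), ZFSet.isTransitive_vonNeumann _, ?_, fun x hx y hy => ?_⟩
  · rw [ZFSet.mem_vonNeumann]
    exact lt_add_of_pos_right _ omega0_pos
  · rw [ZFSet.mem_vonNeumann] at *
    simp only [ZFSet.pair, ZFSet.rank_pair, ZFSet.rank_singleton]
    have h (o : Ordinal) (ho : o < a.rank + ω) : Order.succ o < a.rank + ω := hlim.succ_lt ho
    exact max_lt (h _ (h _ hx)) (h _ (max_lt (h _ hx) (h _ hy)))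

/-- A subset `D` of a preorder is predense if each element is compatible with one of `D`. -/
def Predense {C : Type*} [Preorder C] (D : Set C) : Prop := ∀ p, ∃ d ∈ D, ∃ t, t ≤ d ∧ t ≤ p

section Coded

variable {C : Type (u + 1)} [Small.{u} C] (e : C → ZFSet.{u})

/-- The code of a subset of `C`. -/
noncomputable def codeSet (D : Set C) : ZFSet.{u} :=
  ZFSet.sep (fun x => ∃ c ∈ D, e c = x) (ZFSet.range e)

theorem mem_codeSet {D : Set C} {x : ZFSet.{u}} : x ∈ codeSet e D ↔ ∃ c ∈ D, e c = x := by
  rw [codeSet, ZFSet.mem_sep, ZFSet.mem_range, and_iff_right_iff_imp]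
  rintro ⟨c, -, h⟩
  exact ⟨c, h⟩

variable {e} [Preorder C] [Nonempty C] (he : Function.Injective e) {Z : ZFSet.{u}} (hZ : Z.Nonempty)

/-- The forcing notion of all pairs `(e c, z)` with `c ∈ C` and `z ∈ Z`, ordered by the first
coordinate. -/
noncomputable def codedForcing : ForcingNotion.{u} where
  carrier := (ZFSet.range e).prod Z
  rel := ZFSet.sep (fun w => ∃ c z c' z', w =
    ZFSet.pair (ZFSet.pair (e c) z) (ZFSet.pair (e c') z') ∧ c ≤ c')
    (((ZFSet.range e).prod Z).prod ((ZFSet.range e).prod Z))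
  nonempty := by
    obtain ⟨z, hz⟩ := hZ
    exact ⟨ZFSet.pair (e (Classical.arbitrary C)) z, ZFSet.pair_mem_prod.2 ⟨ZFSet.mem_range_self _, hz⟩⟩
  rel_subset := fun _ h => (ZFSet.mem_sep.1 h).1
  refl := by
    intro p hp
    obtain ⟨a, ha, z, hz, rfl⟩ := ZFSet.mem_prod.1 hp
    obtain ⟨c, rfl⟩ := ZFSet.mem_range.1 ha
    exact ZFSet.mem_sep.2 ⟨ZFSet.pair_mem_prod.2 ⟨hp, hp⟩, c, z, c, z, rfl, le_rfl⟩
  trans := by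
    intro p q r hpq hqr
    rw [ZFSet.mem_sep, ZFSet.pair_mem_prod] at *
    obtain ⟨⟨hp, -⟩, c, z, c', z', h, hc⟩ := hpq
    obtain ⟨⟨-, hr⟩, d, w, d', w', h', hd⟩ := hqr
    obtain ⟨rfl, rfl⟩ := ZFSet.pair_inj.1 h
    obtain ⟨h'', rfl⟩ := ZFSet.pair_inj.1 h'
    obtain ⟨h1, rfl⟩ := ZFSet.pair_inj.1 h''
    obtain rfl := he h1
    exact ⟨⟨hp, hr⟩, c, z, d', w', rfl, hc.trans hd⟩

theorem codedForcing_mem_carrier {p : ZFSet.{u}} :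
    p ∈ (codedForcing he hZ).carrier ↔ ∃ c, ∃ z ∈ Z, p = ZFSet.pair (e c) z := by
  simp [codedForcing, ZFSet.mem_prod]

theorem codedForcing_le {c c' : C} {z z' : ZFSet.{u}} :
    (codedForcing he hZ).le (ZFSet.pair (e c) z) (ZFSet.pair (e c') z') ↔
      z ∈ Z ∧ z' ∈ Z ∧ c ≤ c' := by
  simp only [ForcingNotion.le, codedForcing, ZFSet.mem_sep, ZFSet.pair_mem_prod, ZFSet.mem_range,
    ZFSet.pair_inj]
  constructor
  · rintro ⟨⟨⟨-, hz⟩, -, hz'⟩, d, w, d', w', ⟨⟨h1, -⟩, h2, -⟩, hd⟩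
    rw [he h1, he h2]
    exact ⟨hz, hz', hd⟩
  · rintro ⟨hz, hz', h⟩
    exact ⟨⟨⟨⟨c, rfl⟩, hz⟩, ⟨c', rfl⟩, hz'⟩, c, z, c', z', ⟨⟨rfl, rfl⟩, rfl, rfl⟩, h⟩

theorem ForcingNotion.le_carrier {P : ForcingNotion.{u}} {p q : ZFSet.{u}} (h : P.le p q) :
    p ∈ P.carrier ∧ q ∈ P.carrier :=
  ZFSet.pair_mem_prod.1 (P.rel_subset h)

/-- If `Z` projects onto a transitive set `W` closed under pairs with `e c ∈ W` and `Z ⊆ W`, then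
the coded forcing is in its `H(|2^P|⁺)`. -/
theorem codedForcing_code_mem {W a : ZFSet.{u}} (hW : W.IsTransitive)
    (hpair : ∀ x ∈ W, ∀ y ∈ W, ZFSet.pair x y ∈ W) (hZW : Z ⊆ W) (heW : ∀ c, e c ∈ W)
    (haZ : ∀ b ∈ W, ZFSet.pair a b ∈ Z) :
    (codedForcing he hZ).code ∈ H (codedForcing he hZ).properCard := by
  set P := codedForcing he hZ
  have hinf : ℵ₀ ≤ P.properCard := (le_max_left _ _).trans (Order.le_succ _)
  have hcW : P.carrier ⊆ W := by
    intro p hp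
    obtain ⟨c, z, hz, rfl⟩ := (codedForcing_mem_carrier he hZ).1 hp
    exact hpair _ (heW c) _ (hZW hz)
  -- The padding coordinate embeds `W` into the carrier, so `W` has size below `|2^P|⁺` and the
  -- carrier and the order, as subsets of `W`, are in the corresponding `H`.
  have hcard : W.card ≤ P.carrier.card := by
    rw [← Cardinal.lift_le.{u + 1}, ← ZFSet.cardinalMk_coe_sort, ← ZFSet.cardinalMk_coe_sort]
    refine Cardinal.mk_le_of_injective (f := fun b : W =>
      (⟨ZFSet.pair (e (Classical.arbitrary C)) (ZFSet.pair a b),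
        (codedForcing_mem_carrier he hZ).2 ⟨_, _, haZ b b.2, rfl⟩⟩ : P.carrier)) ?_
    intro b b' h
    have := congrArg Subtype.val h
    exact Subtype.ext (ZFSet.pair_inj.1 (ZFSet.pair_inj.1 this).2).2
  have hlt : W.card < P.properCard := by
    rw [ForcingNotion.properCard, Order.lt_succ_iff]
    exact hcard.trans ((cantor _).le.trans (le_max_right _ _))
  refine pair_mem_H hinf (mem_H_of_subset_transitive hW hlt hcW)
    (mem_H_of_subset_transitive hW hlt fun w hw => ?_)
  obtain ⟨p, hp, q, hq, rfl⟩ := ZFSet.mem_prod.1 (P.rel_subset hw)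
  exact hpair _ (hcW hp) _ (hcW hq)

end Coded

theorem toZFSet_nat_mem {M : ZFSet.{u}} (h0 : ∅ ∈ M)
    (hs : ∀ n : ℕ, (n : Ordinal.{u}).toZFSet ∈ M → ((n + 1 : ℕ) : Ordinal.{u}).toZFSet ∈ M)
    (n : ℕ) : (n : Ordinal.{u}).toZFSet ∈ M := by
  induction n with
  | zero => simpa using h0
  | succ n ih => exact hs n ih

theorem PFA.exists_filter (pfa : PFA.{u}) {C : Type (u + 1)} [Preorder C] [Nonempty C]
    [Small.{u} C] {e : C → ZFSet.{u}} (he : Function.Injective e)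
    {ι : Type} [Countable ι] (F : ι → ZFSet.{u} → ZFSet.{u}) (S : ZFSet.{u})
    (hproper : ∀ M : ZFSet.{u}, (M : Set ZFSet.{u}).Countable →
      (∀ a ∈ M, ∀ b ∈ M, ZFSet.pair a b ∈ M) → (∀ i, ∀ a ∈ M, a ∈ S → F i a ∈ M) →
      ∀ c, e c ∈ M → ∃ c' ≤ c, ∀ r ≤ c', ∀ D : Set C, Predense D → codeSet e D ∈ M →
        ∃ s ∈ D, e s ∈ M ∧ ∃ t, t ≤ s ∧ t ≤ r)
    {κ : Type (u + 1)} (hκ : #κ ≤ ℵ₁) (𝒟 : κ → Set C)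
    (hdense : ∀ i p, ∃ q ≤ p, q ∈ 𝒟 i) :
    ∃ G : Set C, G.Nonempty ∧ (∀ p ∈ G, ∀ q ∈ G, ∃ r ∈ G, r ≤ p ∧ r ≤ q) ∧
      ∀ i, ∃ p ∈ G, p ∈ 𝒟 i := by
  obtain ⟨g, hg⟩ := Countable.exists_injective_nat ι
  let nat (n : ℕ) : ZFSet.{u} := (n : Ordinal.{u}).toZFSet
  have hnat : Function.Injective nat := fun m n h => by
    simpa [nat] using Ordinal.toZFSet_injective h
  -- `F i a` is the fibre of `T` over `(nat (g i), a)`, and `nat (n + 1)` is the fibre of `N` over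
  -- `nat n`. A model containing `T`, `N` and `∅` thus obtains all numerals and then all values `F i
  -- a` with `a ∈ S`.
  let T : ZFSet.{u} := ZFSet.range (α := Σ (i : ι) (a : S), F i a)
    (fun q => ZFSet.pair (ZFSet.pair (nat (g q.1)) q.2.1) q.2.2)
  let N : ZFSet.{u} := ZFSet.range (α := Σ n : ℕ, nat (n + 1))
    (fun q => ZFSet.pair (nat q.1) q.2)
  have hT (i : ι) (a z : ZFSet) (ha : a ∈ S) :
      ZFSet.pair (ZFSet.pair (nat (g i)) a) z ∈ T ↔ z ∈ F i a := by
    simp only [T, ZFSet.mem_range, ZFSet.pair_inj]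
    constructor
    · rintro ⟨⟨j, ⟨b, hb⟩, w, hw⟩, ⟨h1, rfl⟩, rfl⟩
      rwa [← hg (hnat h1)]
    · exact fun hz => ⟨⟨i, ⟨a, ha⟩, z, hz⟩, ⟨rfl, rfl⟩, rfl⟩
  have hN (n : ℕ) (z : ZFSet) : ZFSet.pair (nat n) z ∈ N ↔ z ∈ nat (n + 1) := by
    simp only [N, ZFSet.mem_range, ZFSet.pair_inj]
    constructor
    · rintro ⟨⟨m, w, hw⟩, h1, rfl⟩
      rwa [← hnat h1]
    · exact fun hz => ⟨⟨n, z, hz⟩, rfl, rfl⟩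
  let A := ZFSet.pair T (ZFSet.pair N ∅)
  obtain ⟨W, hWt, hAW, hWp⟩ := exists_transitive_pair_closed (ZFSet.pair A (ZFSet.range e))
  obtain ⟨hAW, heW⟩ := pair_mem_transitive hWt hAW
  have heW (c : C) : e c ∈ W := hWt _ heW (ZFSet.mem_range.2 ⟨c, rfl⟩)
  -- `A` occurs in every condition, so it belongs to each elementary submodel that contains one. The
  -- factor `W` serves only to make the carrier large.
  let Z := ({A} : ZFSet).prod W
  have hZ : Z.Nonempty := ⟨ZFSet.pair A A, by simp [Z, hAW]⟩
  have hZmem (z : ZFSet) : z ∈ Z ↔ ∃ b ∈ W, z = ZFSet.pair A b := by simp [Z, ZFSet.mem_prod]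
  let P := codedForcing he hZ
  have hcode : P.code ∈ H P.properCard := by
    refine codedForcing_code_mem he hZ (a := A) hWt hWp (fun z hz => ?_) heW
      fun b hb => (hZmem _).2 ⟨b, hb, rfl⟩
    obtain ⟨b, hb, rfl⟩ := (hZmem z).1 hz
    exact hWp _ hAW _ hb
  have hPproper : P.IsProper := by
    intro tri _ M hM _ p hp hpM
    have hinf : ℵ₀ ≤ P.properCard := (le_max_left _ _).trans (Order.le_succ _)
    have hcl := hM.isClosedModel hinf
    obtain ⟨c, z, hz, rfl⟩ := (codedForcing_mem_carrier he hZ).1 hp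
    obtain ⟨b, hb, rfl⟩ := (hZmem z).1 hz
    have hAM : A ∈ M := hcl.left _ _ (hcl.right _ _ hpM)
    have hTM : T ∈ M := hcl.left _ _ hAM
    have hNM : N ∈ M := hcl.left _ _ (hcl.right _ _ hAM)
    have h0M : ∅ ∈ M := hcl.right _ _ (hcl.right _ _ hAM)
    have hnatM (n : ℕ) : nat n ∈ M := by
      refine toZFSet_nat_mem h0M (fun n hn => ?_) n
      obtain ⟨y, hy, h⟩ := hcl.fibre _ hNM _ hn
      have : y = nat (n + 1) := ZFSet.ext fun z => (h z).trans (hN n z)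
      rwa [this] at hy
    have hFM (i : ι) (a : ZFSet) (ha : a ∈ M) (haS : a ∈ S) : F i a ∈ M := by
      obtain ⟨y, hy, h⟩ := hcl.fibre _ hTM _ (hcl.pair _ (hnatM (g i)) _ ha)
      have : y = F i a := ZFSet.ext fun z => (h z).trans (hT i a z haS)
      rwa [this] at hy
    have hctbl : (M : Set ZFSet).Countable := (ZFSet.mem_sep.1 hM.1).2
    obtain ⟨c', hc', hgen⟩ := hproper M hctbl hcl.pair hFM c (hcl.left _ _ hpM)
    refine ⟨ZFSet.pair (e c') (ZFSet.pair A b), (codedForcing_le he hZ).2 ⟨hz, hz, hc'⟩, ?_⟩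
    intro r hr D hDM hD
    obtain ⟨r, w, hw, rfl⟩ := (codedForcing_mem_carrier he hZ).1 (ForcingNotion.le_carrier hr).1
    have hr' := ((codedForcing_le he hZ).1 hr).2.2
    -- Second coordinates do not affect the order, so the projection of `D` is predense in `C`; its
    -- code is the domain of the relation `D`, hence in `M`.
    let E : Set C := {d | ∃ b, ZFSet.pair (e d) b ∈ D}
    have hE : Predense E := by
      intro q
      obtain ⟨d, hd, t, htd, htq⟩ := hD.2 (ZFSet.pair (e q) w)
        ((codedForcing_mem_carrier he hZ).2 ⟨q, w, hw, rfl⟩)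
      obtain ⟨d, y, -, rfl⟩ := (codedForcing_mem_carrier he hZ).1 (ForcingNotion.le_carrier htd).2
      obtain ⟨t, y', -, rfl⟩ := (codedForcing_mem_carrier he hZ).1 (ForcingNotion.le_carrier htd).1
      exact ⟨d, ⟨y, hd⟩, t, ((codedForcing_le he hZ).1 htd).2.2,
        ((codedForcing_le he hZ).1 htq).2.2⟩
    have hEM : codeSet e E ∈ M := by
      obtain ⟨y, hy, h⟩ := hcl.domain _ hDM
      have : y = codeSet e E := by
        refine ZFSet.ext fun z => (h z).trans ?_
        rw [mem_codeSet]
        constructor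
        · rintro ⟨b, hb⟩
          obtain ⟨d, y, -, h⟩ := (codedForcing_mem_carrier he hZ).1 (hD.1 hb)
          obtain ⟨rfl, rfl⟩ := ZFSet.pair_inj.1 h
          exact ⟨d, ⟨_, hb⟩, rfl⟩
        · rintro ⟨d, hd, rfl⟩
          exact hd
      rwa [this] at hy
    obtain ⟨s, ⟨y, hsy⟩, hsM, t, hts, htr⟩ := hgen r hr' E hE hEM
    -- Lift `s` back to `D ∩ M`: the fibre of `D` over `e s` is a nonempty element of `M`, so it has
    -- an element in `M`.
    obtain ⟨x, hxM, hx⟩ := hcl.fibre _ hDM _ hsM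
    obtain ⟨y', hy', hy'M⟩ := hcl.mem x hxM ⟨y, (hx y).2 hsy⟩
    rw [hx] at hy'
    have hy'Z : y' ∈ Z := by
      obtain ⟨d, u, hu, h⟩ := (codedForcing_mem_carrier he hZ).1 (hD.1 hy')
      rwa [(ZFSet.pair_inj.1 h).2]
    exact ⟨_, hy', hcl.pair _ hsM _ hy'M, ZFSet.pair (e t) w,
      (codedForcing_le he hZ).2 ⟨hw, hy'Z, hts⟩, (codedForcing_le he hZ).2 ⟨hw, hw, htr⟩⟩
  let 𝓓 (i : κ) : ZFSet.{u} := ZFSet.sep (fun p => ∃ c ∈ 𝒟 i, ∃ z, p = ZFSet.pair (e c) z) P.carrier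
  obtain ⟨G, hG, hGD⟩ := pfa P hcode hPproper (Set.range 𝓓) (mk_range_le.trans hκ) (by
    rintro _ ⟨i, rfl⟩
    refine ⟨fun p hp => (ZFSet.mem_sep.1 hp).1, fun p hp => ?_⟩
    obtain ⟨c, z, hz, rfl⟩ := (codedForcing_mem_carrier he hZ).1 hp
    obtain ⟨q, hq, hqD⟩ := hdense i c
    exact ⟨ZFSet.pair (e q) z, ZFSet.mem_sep.2 ⟨(codedForcing_mem_carrier he hZ).2 ⟨q, z, hz, rfl⟩,
      q, hqD, z, rfl⟩, (codedForcing_le he hZ).2 ⟨hz, hz, hq⟩⟩)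
  refine ⟨{c | ∃ z, ZFSet.pair (e c) z ∈ G}, ?_, ?_, fun i => ?_⟩
  · obtain ⟨p, hp⟩ := hG.nonempty
    obtain ⟨c, z, hz, rfl⟩ := (codedForcing_mem_carrier he hZ).1 (hG.subset p hp)
    exact ⟨c, z, hp⟩
  · rintro p ⟨z, hp⟩ q ⟨w, hq⟩
    obtain ⟨r, hr, hrp, hrq⟩ := hG.directed _ hp _ hq
    obtain ⟨r, y, hy, rfl⟩ := (codedForcing_mem_carrier he hZ).1 (hG.subset r hr)
    exact ⟨r, ⟨y, hr⟩, ((codedForcing_le he hZ).1 hrp).2.2, ((codedForcing_le he hZ).1 hrq).2.2⟩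
  · obtain ⟨p, hp, hpD⟩ := hGD (𝓓 i) ⟨i, rfl⟩
    obtain ⟨c, hc, z, rfl⟩ := (ZFSet.mem_sep.1 hpD).2
    exact ⟨c, ⟨z, hp⟩, hc⟩

/-! ### Countable sets and countable ordinals -/

theorem mem_ctbl {X Y : ZFSet.{u}} : Y ∈ ctbl X ↔ Y ⊆ X ∧ (Y : Set ZFSet.{u}).Countable := by
  rw [ctbl, ZFSet.mem_sep, ZFSet.mem_powerset]

theorem exists_mem_ctbl {X : ZFSet.{u}} {s : Set ZFSet.{u}} (hs : s.Countable)
    (hX : ∀ y ∈ s, y ∈ X) : ∃ Y ∈ ctbl X, ∀ y, y ∈ Y ↔ y ∈ s := by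
  have h (y : ZFSet.{u}) : y ∈ ZFSet.sep (· ∈ s) X ↔ y ∈ s := by
    rw [ZFSet.mem_sep]
    exact ⟨fun h => h.2, fun h => ⟨hX y h, h⟩⟩
  refine ⟨ZFSet.sep (· ∈ s) X, mem_ctbl.2 ⟨fun y hy => (ZFSet.mem_sep.1 hy).1, ?_⟩, h⟩
  exact hs.mono fun y hy => (h y).1 hy

theorem countable_Iio_of_lt_omega_one {o : Ordinal.{u}} (h : o < ω₁) : (Set.Iio o).Countable := by
  rw [← Cardinal.le_aleph0_iff_set_countable, Cardinal.mk_Iio_ordinal, ← Cardinal.lift_aleph0.{u + 1, u},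
    Cardinal.lift_le, ← Order.lt_succ_iff, succ_aleph0, ← Cardinal.lt_ord, ord_aleph]
  exact h

theorem succ_lt_omega_one {o : Ordinal.{u}} (h : o < ω₁) : Order.succ o < ω₁ :=
  (isSuccLimit_omega 1).succ_lt h

theorem countable_Iic_of_lt_omega_one {o : Ordinal.{u}} (h : o < ω₁) : (Set.Iic o).Countable := by
  rw [← Order.Iio_succ]
  exact countable_Iio_of_lt_omega_one (succ_lt_omega_one h)

/-! ### Good models and the forcing of reflecting chains -/

namespace OpenStationaryMap

variable (S : OpenStationaryMap.{u})

theorem aleph0_lt : ℵ₀ < S.θ := by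
  obtain ⟨t, -, hXt, hc⟩ := MappingReflection.mem_H.1 S.mem_H
  refine lt_of_not_ge fun h => S.uncountable ?_
  have h2 : (t : Set ZFSet.{u}).Countable := by
    have : #t ≤ ℵ₀ := by
      rw [ZFSet.cardinalMk_coe_sort, ← Cardinal.lift_aleph0.{u + 1, u}, Cardinal.lift_le]
      exact hc.le.trans h
    exact Cardinal.mk_le_aleph0_iff.1 this
  exact h2.mono fun y hy => hXt hy

/-- An element of the domain is good if its countable elements are subsets. -/
def IsGood (K : ZFSet.{u}) : Prop :=
  K ∈ S.dom ∧ ∀ Y ∈ K, (Y : Set ZFSet.{u}).Countable → Y ⊆ K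

variable {S}

theorem mem_ctbl_H_of_mem_dom {K : ZFSet.{u}} (h : K ∈ S.dom) : K ∈ ctbl (H S.θ) :=
  (S.elementary K h).1

theorem countable_mem_H {Y : ZFSet.{u}} (h : Y ∈ ctbl (H S.θ)) : Y ∈ H S.θ :=
  countable_subset_mem_H S.regular S.aleph0_lt h

theorem IsGood.mem_ctbl {K : ZFSet.{u}} (h : S.IsGood K) : K ∈ ctbl (H S.θ) :=
  mem_ctbl_H_of_mem_dom h.1

theorem IsGood.mem_H {K : ZFSet.{u}} (h : S.IsGood K) : K ∈ H S.θ :=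
  countable_mem_H h.mem_ctbl

theorem IsGood.countable {K : ZFSet.{u}} (h : S.IsGood K) : (K : Set ZFSet.{u}).Countable :=
  (MappingReflection.mem_ctbl.1 h.mem_ctbl).2

theorem IsGood.subset_H {K : ZFSet.{u}} (h : S.IsGood K) : K ⊆ H S.θ :=
  (MappingReflection.mem_ctbl.1 h.mem_ctbl).1

theorem IsGood.subset_of_mem {K L : ZFSet.{u}} (hK : S.IsGood K) (hL : S.IsGood L) (h : K ∈ L) :
    K ⊆ L :=
  hL.2 K h hK.countable

theorem mem_H_of_mem_base {x : ZFSet.{u}} (hx : x ∈ S.X) : x ∈ H S.θ :=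
  H_isTransitive _ _ S.mem_H hx

/-- Pass ω times to a larger member of the club that includes all countable elements of the previous
one. The union stays in the club, and each of its countable elements appears at a finite stage. -/
theorem exists_good (hS : IsClub (H S.θ) S.dom) {s : Set ZFSet.{u}} (hs : s.Countable)
    (hH : ∀ y ∈ s, y ∈ H S.θ) : ∃ K, S.IsGood K ∧ ∀ y ∈ s, y ∈ K := by
  have ext (t : Set ZFSet.{u}) (ht : t.Countable) (hH : ∀ y ∈ t, y ∈ H S.θ) :
      ∃ K ∈ S.dom, ∀ y ∈ t, y ∈ K := by
    obtain ⟨Y, hY, hYt⟩ := exists_mem_ctbl ht hH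
    obtain ⟨K, hK, hYK⟩ := hS.cofinal Y hY
    exact ⟨K, hK, fun y hy => hYK ((hYt y).2 hy)⟩
  have step (K : S.dom) : ∃ L : S.dom, (K : ZFSet) ⊆ (L : ZFSet) ∧
      ∀ Y ∈ (K : ZFSet), (Y : Set ZFSet).Countable → Y ⊆ (L : ZFSet) := by
    obtain ⟨hKH, hKc⟩ := mem_ctbl.1 (mem_ctbl_H_of_mem_dom K.2)
    obtain ⟨L, hL, h⟩ := ext ((K : ZFSet) ∪ ⋃ Y ∈ {Y : ZFSet | Y ∈ (K : ZFSet) ∧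
        (Y : Set ZFSet).Countable}, (Y : Set ZFSet)) (by
      refine hKc.union (Set.Countable.biUnion (hKc.mono fun Y hY => hY.1) fun Y hY => hY.2)) (by
      rintro y (hy | hy)
      · exact hKH hy
      · simp only [Set.mem_iUnion] at hy
        obtain ⟨Y, hY, hy⟩ := hy
        exact H_isTransitive _ _ (hKH hY.1) hy)
    refine ⟨⟨L, hL⟩, fun y hy => h y (Or.inl hy), fun Y hY hYc y hy => h y (Or.inr ?_)⟩
    simp only [Set.mem_iUnion]
    exact ⟨Y, ⟨hY, hYc⟩, hy⟩
  choose next hnext using step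
  obtain ⟨K₀, hK₀, hs₀⟩ := ext s hs hH
  let f : ℕ → S.dom := fun n => next^[n] ⟨K₀, hK₀⟩
  have hf (n : ℕ) : f (n + 1) = next (f n) := Function.iterate_succ_apply' _ _ _
  refine ⟨ZFSet.iUnion fun n => (f n : ZFSet), ⟨hS.closed _ (fun n => (f n).2) fun n => ?_, ?_⟩, ?_⟩
  · rw [hf]; exact (hnext _).1
  · intro Y hY hYc y hy
    obtain ⟨n, hn⟩ := ZFSet.mem_iUnion.1 hY
    exact ZFSet.mem_iUnion.2 ⟨n + 1, by rw [hf]; exact (hnext _).2 Y hn hYc hy⟩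
  · exact fun y hy => ZFSet.mem_iUnion.2 ⟨0, hs₀ y hy⟩

variable (S)

/-- The conditions of the forcing for `MRP`: countable continuous `∈`-chains of good models of
successor length `len + 1` which reflect `S`. -/
structure Cond where
  len : Ordinal.{u}
  f : Ordinal.{u} → ZFSet.{u}
  len_lt : len < ω₁
  eq_empty : ∀ ξ, len < ξ → f ξ = ∅
  good : ∀ ξ ≤ len, S.IsGood (f ξ)
  mem : ∀ ξ ν, ξ < ν → ν ≤ len → f ξ ∈ f ν
  union : ∀ ν ≤ len, Order.IsSuccLimit ν → ∀ x ∈ f ν, ∃ ξ < ν, x ∈ f ξ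
  reflect : ∀ ν ≤ len, Order.IsSuccLimit ν →
    ∃ ν₀ < ν, ∀ ξ, ν₀ < ξ → ξ < ν → f ξ ∩ S.X ∈ S.map (f ν)

variable {S}

namespace Cond

instance : Preorder S.Cond where
  le c d := d.len ≤ c.len ∧ ∀ ξ ≤ d.len, c.f ξ = d.f ξ
  le_refl c := ⟨le_rfl, fun _ _ => rfl⟩
  le_trans a b c hab hbc :=
    ⟨hbc.1.trans hab.1, fun ξ hξ => (hab.2 ξ (hξ.trans hbc.1)).trans (hbc.2 ξ hξ)⟩

/-- The default value `∅` beyond `len` makes a condition determined by its length and its values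
below `ω₁`, which lie in a fixed set. -/
instance : Small.{u} S.Cond := by
  let W : ZFSet.{u} := insert ∅ S.dom
  have hW (c : S.Cond) (ξ : Ordinal.{u}) : c.f ξ ∈ W := by
    rw [ZFSet.mem_insert_iff]
    rcases le_or_gt ξ c.len with h | h
    · exact Or.inr (c.good ξ h).1
    · exact Or.inl (c.eq_empty ξ h)
  refine small_of_injective (β := Set.Iio (ω₁ : Ordinal.{u}) × (Set.Iio (ω₁ : Ordinal.{u}) → W))
    (f := fun c => (⟨c.len, c.len_lt⟩, fun ξ => ⟨c.f ξ, hW c ξ⟩)) ?_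
  intro c d h
  obtain ⟨h1, h2⟩ := Prod.mk.inj h
  have hlen : c.len = d.len := congrArg Subtype.val h1
  have hf : c.f = d.f := by
    funext ξ
    rcases lt_or_ge ξ ω₁ with hξ | hξ
    · exact congrArg Subtype.val (congrFun h2 ⟨ξ, hξ⟩)
    · rw [c.eq_empty ξ (c.len_lt.trans_le hξ), d.eq_empty ξ (d.len_lt.trans_le hξ)]
  cases c; cases d
  simp only at hlen hf
  subst hlen hf
  rfl

/-- The last model of a condition. -/
def top (c : S.Cond) : ZFSet.{u} := c.f c.len

theorem top_good (c : S.Cond) : S.IsGood c.top := c.good _ le_rfl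

theorem subset {c : S.Cond} {ξ ν : Ordinal.{u}} (h : ξ ≤ ν) (hν : ν ≤ c.len) :
    c.f ξ ⊆ c.f ν := by
  rcases h.eq_or_lt with rfl | h
  · rfl
  · exact (c.good ξ (h.le.trans hν)).subset_of_mem (c.good ν hν) (c.mem ξ ν h hν)

theorem top_subset_of_le {c d : S.Cond} (h : d ≤ c) : c.top ⊆ d.top := by
  have := d.subset h.1 le_rfl
  rwa [h.2 _ le_rfl] at this

theorem exists_of_good {K : ZFSet.{u}} (hK : S.IsGood K) : ∃ c : S.Cond, c.top = K := by
  refine ⟨⟨0, fun ξ => if ξ = 0 then K else ∅, omega_pos 1, fun ξ h => if_neg h.ne', ?_, ?_, ?_,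
    ?_⟩, if_pos rfl⟩
  · intro ξ h
    rwa [if_pos (nonpos_iff_eq_zero.1 h)]
  · intro ξ ν h hν
    exact absurd (h.trans_le hν) not_lt_zero
  · intro ν hν h
    exact absurd (nonpos_iff_eq_zero.1 hν) h.ne_bot
  · intro ν hν h
    exact absurd (nonpos_iff_eq_zero.1 hν) h.ne_bot

/-- Adding one more model on top of a condition. -/
theorem exists_append (c : S.Cond) {K : ZFSet.{u}} (hK : S.IsGood K) (h : c.top ∈ K) :
    ∃ d ≤ c, d.len = Order.succ c.len ∧ d.top = K := by
  let g : Ordinal.{u} → ZFSet.{u} := fun ξ => if ξ = Order.succ c.len then K else c.f ξ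
  have hg (ξ : Ordinal.{u}) (hξ : ξ ≤ c.len) : g ξ = c.f ξ :=
    if_neg (Order.lt_succ_iff.2 hξ).ne
  have hgK : g (Order.succ c.len) = K := if_pos rfl
  have hlim (ν : Ordinal.{u}) (hν : ν ≤ Order.succ c.len) (h : Order.IsSuccLimit ν) :
      ν ≤ c.len := by
    rcases hν.eq_or_lt with rfl | hν
    · exact absurd h (Order.not_isSuccLimit_succ _)
    · exact Order.lt_succ_iff.1 hν
  refine ⟨⟨Order.succ c.len, g, succ_lt_omega_one c.len_lt, ?_, ?_, ?_, ?_, ?_⟩,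
    ⟨Order.le_succ _, hg⟩, rfl, hgK⟩
  · intro ξ hξ
    simp only [g, if_neg hξ.ne']
    exact c.eq_empty ξ ((Order.lt_succ _).trans hξ)
  · intro ξ hξ
    rcases hξ.eq_or_lt with rfl | hξ
    · rwa [hgK]
    · rw [hg _ (Order.lt_succ_iff.1 hξ)]
      exact c.good _ (Order.lt_succ_iff.1 hξ)
  · intro ξ ν hξν hν
    rcases hν.eq_or_lt with rfl | hν
    · rw [hgK, hg _ (Order.lt_succ_iff.1 hξν)]
      rcases (Order.lt_succ_iff.1 hξν).eq_or_lt with rfl | hξ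
      · exact h
      · exact c.top_good.subset_of_mem hK h (c.mem ξ _ hξ le_rfl)
    · have hν' := Order.lt_succ_iff.1 hν
      rw [hg _ hν', hg _ (hξν.le.trans hν')]
      exact c.mem ξ ν hξν hν'
  · intro ν hν hl x hx
    have hν' := hlim ν hν hl
    rw [hg _ hν'] at hx
    obtain ⟨ξ, hξ, hx⟩ := c.union ν hν' hl x hx
    exact ⟨ξ, hξ, by rwa [hg _ (hξ.le.trans hν')]⟩
  · intro ν hν hl
    have hν' := hlim ν hν hl
    obtain ⟨ν₀, hν₀, h⟩ := c.reflect ν hν' hl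
    refine ⟨ν₀, hν₀, fun ξ h1 h2 => ?_⟩
    rw [hg _ hν', hg _ (h2.le.trans hν')]
    exact h ξ h1 h2

theorem exists_extension (hS : IsClub (H S.θ) S.dom) (c : S.Cond) {s : Set ZFSet.{u}}
    (hs : s.Countable) (hH : ∀ y ∈ s, y ∈ H S.θ) :
    ∃ d ≤ c, d.len = Order.succ c.len ∧ ∀ y ∈ s, y ∈ d.top := by
  obtain ⟨K, hK, h⟩ := exists_good hS (hs.insert c.top) (by
    rintro y (rfl | hy)
    exacts [c.top_good.mem_H, hH y hy])
  obtain ⟨d, hd, hl, rfl⟩ := c.exists_append hK (h _ (Set.mem_insert _ _))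
  exact ⟨d, hd, hl, fun y hy => h y (Set.mem_insert_of_mem _ hy)⟩

/-! ### The club of reachable countable subsets of X -/

/-- `r` properly extends `c`, lies below a member of `D`, and the traces on `X` of all new models
are between `x` and `Y`. -/
structure Reaches (c : S.Cond) (D : Set S.Cond) (x : Set ZFSet.{u}) (Y : ZFSet.{u})
    (r : S.Cond) : Prop where
  le : r ≤ c
  len_lt : c.len < r.len
  below : ∃ d ∈ D, r ≤ d
  lower : ∀ ξ, c.len < ξ → ξ ≤ r.len → ∀ z ∈ x, z ∈ r.f ξ
  upper : ∀ ξ, c.len < ξ → ξ ≤ r.len → r.f ξ ∩ S.X ⊆ Y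

/-- Append a model containing `x` before using predensity; all later models include it. -/
theorem exists_reaches (hS : IsClub (H S.θ) S.dom) (c : S.Cond) {D : Set S.Cond}
    (hD : Predense D) {x : Set ZFSet.{u}} (hx : x.Finite) (hxX : ∀ z ∈ x, z ∈ S.X) :
    ∃ r, c.Reaches D x S.X r := by
  obtain ⟨c', hc', hl, hxc⟩ := c.exists_extension hS hx.countable
    fun y hy => mem_H_of_mem_base (hxX y hy)
  obtain ⟨d, hd, r, hrd, hrc⟩ := hD c'
  refine ⟨r, hrc.trans hc', ?_, ⟨d, hd, hrd⟩, fun ξ h1 h2 z hz => ?_, fun ξ _ _ z hz => ?_⟩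
  · exact Order.succ_le_iff.1 (hl ▸ hrc.1)
  · have h := r.subset (Order.succ_le_of_lt h1) h2
    rw [← hl, hrc.2 _ le_rfl] at h
    exact h (hxc z hz)
  · exact (ZFSet.mem_inter.1 hz).2

/-- The club of all countable `Y ⊆ X` such that each finite `x ⊆ Y` can be reached within `Y`. -/
noncomputable def clubSet (c : S.Cond) (D : Set S.Cond) : ZFSet.{u} :=
  ZFSet.sep (fun Y => ∀ x : Set ZFSet.{u}, x.Finite → (∀ z ∈ x, z ∈ Y) → ∃ r, c.Reaches D x Y r)
    (ctbl S.X)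

theorem Reaches.mono {c r : S.Cond} {D : Set S.Cond} {x : Set ZFSet.{u}} {Y Y' : ZFSet.{u}}
    (h : c.Reaches D x Y r) (hY : Y ⊆ Y') : c.Reaches D x Y' r :=
  ⟨h.le, h.len_lt, h.below, h.lower, fun ξ h1 h2 _ hz => hY (h.upper ξ h1 h2 hz)⟩

theorem exists_finite_subset_of_chain {x : Set ZFSet.{u}} (hx : x.Finite) {f : ℕ → Set ZFSet.{u}}
    (hf : Monotone f) (h : ∀ z ∈ x, ∃ n, z ∈ f n) : ∃ n, ∀ z ∈ x, z ∈ f n := by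
  induction x, hx using Set.Finite.induction_on with
  | empty => exact ⟨0, by simp⟩
  | @insert a s _ _ ih =>
    obtain ⟨n, hn⟩ := ih fun z hz => h z (Set.mem_insert_of_mem _ hz)
    obtain ⟨m, hm⟩ := h a (Set.mem_insert _ _)
    refine ⟨max n m, ?_⟩
    rintro z (rfl | hz)
    · exact hf (le_max_right _ _) hm
    · exact hf (le_max_left _ _) (hn z hz)

/-- For cofinality, fix a reaching condition for each finite `x ⊆ X` and close `Y` under adding the
points of `X` in its models; each round adds countably many points. For closure, a finite subset of
an increasing union lies in one term. -/
theorem isClub_clubSet (hS : IsClub (H S.θ) S.dom) (c : S.Cond) {D : Set S.Cond}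
    (hD : Predense D) : IsClub S.X (c.clubSet D) := by
  refine ⟨fun Y hY => (ZFSet.mem_sep.1 hY).1, fun Y hY => ?_, fun f hf hmono => ?_⟩
  · have hex (x : Set ZFSet.{u}) : ∃ r, x.Finite → (∀ z ∈ x, z ∈ S.X) → c.Reaches D x S.X r := by
      by_cases hx : x.Finite ∧ ∀ z ∈ x, z ∈ S.X
      · obtain ⟨r, hr⟩ := c.exists_reaches hS hD hx.1 hx.2
        exact ⟨r, fun _ _ => hr⟩
      · exact ⟨c, fun h1 h2 => absurd ⟨h1, h2⟩ hx⟩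
    choose R hR using hex
    let F (x : Set ZFSet.{u}) : Set ZFSet.{u} :=
      {z | z ∈ S.X ∧ ∃ ξ ∈ Set.Iic (R x).len, z ∈ (R x).f ξ}
    have hF (x : Set ZFSet.{u}) : (F x).Countable := by
      refine ((countable_Iic_of_lt_omega_one (R x).len_lt).biUnion
        (t := fun ξ _ => ((R x).f ξ : Set ZFSet.{u})) fun ξ hξ => ((R x).good ξ hξ).countable).mono ?_
      rintro z ⟨-, ξ, hξ, hz⟩
      simp only [Set.mem_iUnion]
      exact ⟨ξ, hξ, hz⟩
    let step (Z : Set ZFSet.{u}) : Set ZFSet.{u} := Z ∪ ⋃ x ∈ {x | x.Finite ∧ x ⊆ Z}, F x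
    let Z : ℕ → Set ZFSet.{u} := fun n => step^[n] Y
    have hZ (n : ℕ) : Z (n + 1) = step (Z n) := Function.iterate_succ_apply' _ _ _
    have hZm : Monotone Z := monotone_nat_of_le_succ fun n => by
      rw [hZ]; exact Set.subset_union_left
    have hZX (n : ℕ) : ∀ z ∈ Z n, z ∈ S.X := by
      induction n with
      | zero => exact fun z hz => (mem_ctbl.1 hY).1 hz
      | succ n ih =>
        rw [hZ]
        rintro z (hz | hz)
        · exact ih z hz
        · simp only [Set.mem_iUnion] at hz
          obtain ⟨x, -, hz⟩ := hz
          exact hz.1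
    have hZc (n : ℕ) : (Z n).Countable := by
      induction n with
      | zero => exact (mem_ctbl.1 hY).2
      | succ n ih =>
        rw [hZ]
        exact ih.union ((Set.countable_ofPred_finite_subset ih).biUnion fun x _ => hF x)
    obtain ⟨V, hV, hVZ⟩ := exists_mem_ctbl (Set.countable_iUnion hZc) (X := S.X) (by
      intro y hy
      obtain ⟨n, hn⟩ := Set.mem_iUnion.1 hy
      exact hZX n y hn)
    simp only [Set.mem_iUnion] at hVZ
    refine ⟨V, ZFSet.mem_sep.2 ⟨hV, fun x hx hxV => ⟨R x, ?_⟩⟩, fun y hy => (hVZ y).2 ⟨0, hy⟩⟩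
    have hr := hR x hx fun z hz => (mem_ctbl.1 hV).1 (hxV z hz)
    refine ⟨hr.le, hr.len_lt, hr.below, hr.lower, fun ξ _ h2 z hz => ?_⟩
    obtain ⟨n, hn⟩ := exists_finite_subset_of_chain hx hZm fun z hz => (hVZ z).1 (hxV z hz)
    rw [ZFSet.mem_inter] at hz
    refine (hVZ z).2 ⟨n + 1, ?_⟩
    rw [hZ]
    refine Or.inr ?_
    simp only [Set.mem_iUnion]
    exact ⟨x, ⟨hx, hn⟩, hz.2, ξ, h2, hz.1⟩
  · refine ZFSet.mem_sep.2 ⟨mem_ctbl.2 ⟨fun z hz => ?_, ?_⟩, fun x hx hxf => ?_⟩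
    · obtain ⟨n, hn⟩ := ZFSet.mem_iUnion.1 hz
      exact (mem_ctbl.1 (ZFSet.mem_sep.1 (hf n)).1).1 hn
    · rw [ZFSet.coe_iUnion]
      exact Set.countable_iUnion fun n => (mem_ctbl.1 (ZFSet.mem_sep.1 (hf n)).1).2
    · obtain ⟨n, hn⟩ := exists_finite_subset_of_chain hx (f := fun n => (f n : Set ZFSet.{u}))
        (monotone_nat_of_le_succ hmono) fun z hz => ZFSet.mem_iUnion.1 (hxf z hz)
      obtain ⟨r, hr⟩ := (ZFSet.mem_sep.1 (hf n)).2 x hx hn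
      exact ⟨r, hr.mono (ZFSet.subset_iUnion f n)⟩

end Cond

end OpenStationaryMap

/-- A basic set `[x, N]` includes `[x, Z]` for each of its members `Z`, and including such an
interval at each member is preserved by finite intersections and arbitrary unions. -/
theorem IsEllentuckOpen.exists_finite {X U Y : ZFSet.{u}} (hU : IsEllentuckOpen X U) (hY : Y ∈ U) :
    ∃ x : Set ZFSet.{u}, x.Finite ∧ (∀ z ∈ x, z ∈ Y) ∧
      ∀ Y' ∈ ctbl X, (∀ z ∈ x, z ∈ Y') → Y' ⊆ Y → Y' ∈ U := by
  have key (V : Set (ctbl X)) (hV : @IsOpen _ (ellentuck X) V) : ∀ Z ∈ V,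
      ∃ x : Set ZFSet.{u}, x.Finite ∧ (∀ z ∈ x, z ∈ (Z : ZFSet.{u})) ∧
        ∀ Y' : ctbl X, (∀ z ∈ x, z ∈ (Y' : ZFSet.{u})) → (Y' : ZFSet.{u}) ⊆ Z → Y' ∈ V := by
    induction hV with
    | basic V hV =>
      obtain ⟨N, x, hx, -, rfl⟩ := hV
      exact fun Z hZ => ⟨x, hx, hZ.1, fun Y' h1 h2 => ⟨h1, fun y hy => hZ.2 (h2 hy)⟩⟩
    | univ => exact fun Z _ => ⟨∅, Set.finite_empty, by simp, fun _ _ _ => trivial⟩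
    | inter V W _ _ ihV ihW =>
      intro Z hZ
      obtain ⟨x, hx, hxZ, h⟩ := ihV Z hZ.1
      obtain ⟨y, hy, hyZ, h'⟩ := ihW Z hZ.2
      refine ⟨x ∪ y, hx.union hy, fun z hz => hz.elim (hxZ z) (hyZ z), fun Y' h1 h2 =>
        ⟨h Y' (fun z hz => h1 z (Or.inl hz)) h2, h' Y' (fun z hz => h1 z (Or.inr hz)) h2⟩⟩
    | sUnion 𝒱 _ ih =>
      rintro Z ⟨V, hV, hZ⟩
      obtain ⟨x, hx, hxZ, h⟩ := ih V hV Z hZ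
      exact ⟨x, hx, hxZ, fun Y' h1 h2 => ⟨V, hV, h Y' h1 h2⟩⟩
  obtain ⟨x, hx, hxY, h⟩ := key _ hU.2 ⟨Y, hU.1 hY⟩ hY
  exact ⟨x, hx, hxY, fun Y' hY' h1 h2 => h ⟨Y', hY'⟩ h1 h2⟩

theorem codeSet_injective {C : Type (u + 1)} [Small.{u} C] {e : C → ZFSet.{u}}
    (he : Function.Injective e) : Function.Injective (codeSet e) := by
  have key (D : Set C) (c : C) : c ∈ D ↔ e c ∈ codeSet e D := by
    rw [mem_codeSet]
    exact ⟨fun h => ⟨c, h, rfl⟩, fun ⟨d, hd, h⟩ => he h ▸ hd⟩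
  intro D E h
  ext c
  rw [key, key, h]

/-! ### Suitable models and generic conditions -/

namespace OpenStationaryMap

variable {S : OpenStationaryMap.{u}}

/-- The closure properties of a countable set which yield generic conditions. -/
structure IsSuitable (e : S.Cond → ZFSet.{u}) (M : ZFSet.{u}) : Prop where
  countable : (M : Set ZFSet.{u}).Countable
  subset : ∀ Y ∈ M, Y ∈ ctbl (H S.θ) → Y ⊆ M
  next : ∀ K ∈ M, ∀ a ∈ M, S.IsGood K → a ∈ H S.θ → ∃ L ∈ M, S.IsGood L ∧ K ∈ L ∧ a ∈ L
  models : ∀ c, e c ∈ M → ∀ ξ ≤ c.len, c.f ξ ∈ M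
  covering : ∀ a ∈ M, a ∈ H S.θ → codeSet e {c | a ∈ c.top} ∈ M
  clubSet : ∀ c D, e c ∈ M → codeSet e D ∈ M → c.clubSet D ∈ M
  reaches : ∀ c D, ∀ Y ∈ M, ∀ x : Set ZFSet.{u}, e c ∈ M → codeSet e D ∈ M → Y ∈ c.clubSet D →
    x.Finite → (∀ z ∈ x, z ∈ Y) → ∃ r, e r ∈ M ∧ c.Reaches D x Y r ∧ ∃ d ∈ D, e d ∈ M ∧ r ≤ d

namespace IsSuitable

variable {e : S.Cond → ZFSet.{u}} {M : ZFSet.{u}}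

/-- Starting from `c.top`, absorb the elements of `M ∩ H(θ)` one by one into good models in `M`.
These are subsets of `M`, so their union is exactly the trace, and the club contains it. -/
theorem exists_trace (hS : IsClub (H S.θ) S.dom) (hM : IsSuitable e M) {c : S.Cond}
    (hc : e c ∈ M) : ∃ K, S.IsGood K ∧ ∀ a, a ∈ K ↔ a ∈ M ∧ a ∈ H S.θ := by
  obtain ⟨K, hK, hKM⟩ := exists_mem_ctbl (s := {a | a ∈ M ∧ a ∈ H S.θ}) (X := H S.θ)
    (hM.countable.mono fun a ha => ha.1) fun a ha => ha.2
  have htop : c.top ∈ M := hM.models c hc _ le_rfl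
  obtain ⟨a, ha⟩ := (mem_ctbl.1 hK).2.exists_eq_range
    ⟨c.top, (hKM _).2 ⟨htop, c.top_good.mem_H⟩⟩
  have haK (n : ℕ) : a n ∈ M ∧ a n ∈ H S.θ := (hKM _).1 (by
    have : a n ∈ (K : Set ZFSet) := ha ▸ ⟨n, rfl⟩
    exact this)
  have step (n : ℕ) (L : {L // S.IsGood L ∧ L ∈ M}) :
      ∃ L' : {L // S.IsGood L ∧ L ∈ M}, (L : ZFSet) ⊆ (L' : ZFSet) ∧ a n ∈ (L' : ZFSet) := by
    obtain ⟨L', hL', hg, h1, h2⟩ := hM.next L L.2.2 (a n) (haK n).1 L.2.1 (haK n).2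
    exact ⟨⟨L', hg, hL'⟩, L.2.1.subset_of_mem hg h1, h2⟩
  choose next hnext using step
  let f : ℕ → {L // S.IsGood L ∧ L ∈ M} := fun n =>
    Nat.rec ⟨c.top, c.top_good, htop⟩ (fun n L => next n L) n
  have hK' : K = ZFSet.iUnion.{u} fun n => ((f n).1 : ZFSet.{u}) := by
    ext z
    rw [ZFSet.mem_iUnion]
    constructor
    · intro hz
      have hz' : z ∈ (K : Set ZFSet) := hz
      rw [ha] at hz'
      obtain ⟨n, rfl⟩ := hz'
      exact ⟨n + 1, (hnext n (f n)).2⟩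
    · rintro ⟨n, hn⟩
      exact (hKM z).2 ⟨hM.subset _ (f n).2.2 (f n).2.1.mem_ctbl hn, (f n).2.1.subset_H hn⟩
  refine ⟨K, ⟨?_, fun Y hY hYc y hy => ?_⟩, hKM⟩
  · rw [hK']
    exact hS.closed _ (fun n => (f n).2.1.1) fun n => (hnext n (f n)).1
  · obtain ⟨hYM, hYH⟩ := (hKM Y).1 hY
    have hYs : Y ⊆ H S.θ := H_isTransitive _ _ hYH
    exact (hKM y).2 ⟨hM.subset Y hYM (mem_ctbl.2 ⟨hYs, hYc⟩) hy, hYs hy⟩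

/-- The core of properness: stationarity supplies `Y`, openness reduces membership in `S.map K` to a
finite `x` and the bound `Y`, and the definition of the club supplies an extension whose new traces
lie between the two. -/
theorem exists_step (hS : IsClub (H S.θ) S.dom) (hM : IsSuitable e M) {K : ZFSet.{u}}
    (hK : S.IsGood K) (hKM : ∀ a, a ∈ K ↔ a ∈ M ∧ a ∈ H S.θ) {c : S.Cond} (hc : e c ∈ M)
    {D : Set S.Cond} (hD : Predense D) (hDM : codeSet e D ∈ M) :
    ∃ r ≤ c, e r ∈ M ∧ c.len < r.len ∧ (∃ d ∈ D, e d ∈ M ∧ r ≤ d) ∧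
      ∀ ξ, c.len < ξ → ξ ≤ r.len → r.f ξ ∩ S.X ∈ S.map K := by
  have hE := c.isClub_clubSet hS hD
  -- The club must be an element of `K`, not only of `M`; it is in `H(θ)` as a subset of `[X]^ω ∈
  -- K`.
  have hEH : c.clubSet D ∈ H S.θ := mem_H_of_subset (hK.subset_H (S.ctbl_mem K hK.1)) hE.subset
  obtain ⟨Y, hYE, hYK, hYM⟩ := (S.stationary K hK.1).2 _
    ((hKM _).2 ⟨hM.clubSet c D hc hDM, hEH⟩) hE
  obtain ⟨x, hx, hxY, hopen⟩ := (S.isOpen K hK.1).exists_finite hYK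
  obtain ⟨r, hrM, hr, hd⟩ := hM.reaches c D Y ((hKM _).1 hYM).1 x hc hDM hYE hx hxY
  refine ⟨r, hr.le, hrM, hr.len_lt, hd, fun ξ h1 h2 => hopen _ ?_ (fun z hz => ?_)
    (hr.upper ξ h1 h2)⟩
  · exact mem_ctbl.2 ⟨fun z hz => (ZFSet.mem_inter.1 hz).2,
      (r.good ξ h2).countable.mono fun z hz => (ZFSet.mem_inter.1 hz).1⟩
  · exact ZFSet.mem_inter.2 ⟨hr.lower ξ h1 h2 z hz, (mem_ctbl.1 (hE.subset hYE)).1 (hxY z hz)⟩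

theorem predense_covering (hS : IsClub (H S.θ) S.dom) {a : ZFSet.{u}} (ha : a ∈ H S.θ) :
    Predense {c : S.Cond | a ∈ c.top} := by
  intro p
  obtain ⟨d, hd, -, h⟩ := p.exists_extension hS (Set.countable_singleton a) (by simpa using ha)
  exact ⟨d, h a rfl, d, le_rfl, hd⟩

end IsSuitable

/-- The limit of a descending sequence of conditions, with a model `K` on top. -/
theorem Cond.exists_limit (p : ℕ → S.Cond) (hp : ∀ n, p (n + 1) ≤ p n)
    (hlen : ∀ n, (p n).len < (p (n + 1)).len) {K : ZFSet.{u}} (hK : S.IsGood K)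
    (hmem : ∀ n, ∀ ξ ≤ (p n).len, (p n).f ξ ∈ K) (hunion : ∀ x ∈ K, ∃ n, x ∈ (p n).top)
    (hreflect : ∀ n, ∀ ξ, (p n).len < ξ → ξ ≤ (p (n + 1)).len →
      (p (n + 1)).f ξ ∩ S.X ∈ S.map K) :
    ∃ q : S.Cond, ∀ n, q ≤ p n := by
  classical
  let δ : Ordinal.{u} := ⨆ n, (p n).len
  have hbdd : BddAbove (Set.range fun n => (p n).len) := bddAbove_of_small
  have hlt (n : ℕ) : (p n).len < δ := (hlen n).trans_le (le_ciSup hbdd (n + 1))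
  have hδ (ξ : Ordinal.{u}) (h : ξ < δ) : ∃ n, ξ < (p n).len := exists_lt_of_lt_ciSup h
  have hanti : Antitone p := antitone_nat_of_succ_le hp
  have hcoh (m n : ℕ) (ξ : Ordinal.{u}) (hm : ξ ≤ (p m).len) (hn : ξ ≤ (p n).len) :
      (p m).f ξ = (p n).f ξ := by
    rcases le_total m n with h | h
    · exact ((hanti h).2 ξ hm).symm
    · exact (hanti h).2 ξ hn
  let g : Ordinal.{u} → ZFSet.{u} := fun ξ =>
    if h : ∃ n, ξ ≤ (p n).len then (p (Nat.find h)).f ξ else if ξ = δ then K else ∅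
  have hg (n : ℕ) (ξ : Ordinal.{u}) (h : ξ ≤ (p n).len) : g ξ = (p n).f ξ := by
    have hex : ∃ n, ξ ≤ (p n).len := ⟨n, h⟩
    simp only [g, dif_pos hex]
    exact hcoh _ _ ξ (Nat.find_spec hex) h
  have hno (ξ : Ordinal.{u}) (h : δ ≤ ξ) : ¬ ∃ n, ξ ≤ (p n).len := by
    rintro ⟨n, hn⟩
    exact (h.trans hn).not_gt (hlt n)
  have hgδ : g δ = K := by simp only [g, dif_neg (hno δ le_rfl), if_pos]
  refine ⟨⟨δ, g, Ordinal.iSup_lt_omega_one fun n => (p n).len_lt, ?_, ?_, ?_, ?_, ?_⟩,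
    fun n => ⟨(hlt n).le, hg n⟩⟩
  · intro ξ h
    simp only [g, dif_neg (hno ξ h.le), if_neg h.ne']
  · intro ξ h
    rcases h.eq_or_lt with rfl | h
    · rwa [hgδ]
    · obtain ⟨n, hn⟩ := hδ ξ h
      rw [hg n ξ hn.le]
      exact (p n).good ξ hn.le
  · intro ξ ν hξ hν
    rcases hν.eq_or_lt with rfl | hν
    · obtain ⟨n, hn⟩ := hδ ξ hξ
      rw [hgδ, hg n ξ hn.le]
      exact hmem n ξ hn.le
    · obtain ⟨n, hn⟩ := hδ ν hν
      rw [hg n ν hn.le, hg n ξ (hξ.trans hn).le]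
      exact (p n).mem ξ ν hξ hn.le
  · intro ν hν hl x hx
    rcases hν.eq_or_lt with rfl | hν
    · rw [hgδ] at hx
      obtain ⟨n, hn⟩ := hunion x hx
      exact ⟨(p n).len, hlt n, by rwa [hg n _ le_rfl]⟩
    · obtain ⟨n, hn⟩ := hδ ν hν
      rw [hg n ν hn.le] at hx
      obtain ⟨ξ, hξ, hx⟩ := (p n).union ν hn.le hl x hx
      exact ⟨ξ, hξ, by rwa [hg n _ (hξ.trans hn).le]⟩
  · intro ν hν hl
    rcases hν.eq_or_lt with rfl | hν
    -- An index `ξ` above `(p 0).len` was added between some `p m` and `p (m + 1)`, where `m + 1` is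
    -- the least stage reaching `ξ`; there `hreflect` applies.
    · refine ⟨(p 0).len, hlt 0, fun ξ h1 h2 => ?_⟩
      obtain ⟨n, hn⟩ := hδ ξ h2
      have hex : ∃ n, ξ ≤ (p n).len := ⟨n, hn.le⟩
      obtain ⟨m, hm⟩ : ∃ m, Nat.find hex = m + 1 := Nat.exists_eq_succ_of_ne_zero fun h0 => by
        have := Nat.find_spec hex
        rw [h0] at this
        exact this.not_gt h1
      have h3 := Nat.find_spec hex
      have h4 := Nat.find_min hex (m := m) (by omega)
      rw [hm] at h3
      rw [hgδ, hg _ ξ h3]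
      exact hreflect m ξ (not_le.1 h4) h3
    · obtain ⟨n, hn⟩ := hδ ν hν
      obtain ⟨ν₀, hν₀, h⟩ := (p n).reflect ν hn.le hl
      refine ⟨ν₀, hν₀, fun ξ h1 h2 => ?_⟩
      rw [hg n ν hn.le, hg n ξ (h2.trans hn).le]
      exact h ξ h1 h2

theorem IsSuitable.exists_generic (hS : IsClub (H S.θ) S.dom) {e : S.Cond → ZFSet.{u}}
    (he : Function.Injective e) {M : ZFSet.{u}} (hM : IsSuitable e M) {c : S.Cond}
    (hc : e c ∈ M) :
    ∃ c' ≤ c, ∀ r ≤ c', ∀ D : Set S.Cond, Predense D → codeSet e D ∈ M →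
      ∃ s ∈ D, e s ∈ M ∧ ∃ t, t ≤ s ∧ t ≤ r := by
  obtain ⟨K, hK, hKM⟩ := hM.exists_trace hS hc
  let 𝓓 : Set (Set S.Cond) := {D | Predense D ∧ codeSet e D ∈ M}
  have h𝓓 : 𝓓.Countable :=
    Set.MapsTo.countable_of_injOn (t := (M : Set ZFSet.{u})) (f := codeSet e) (fun D hD => hD.2)
      (codeSet_injective he).injOn hM.countable
  -- Having these among the sets to be met makes the top models exhaust `K`, which is continuity at
  -- the new limit.
  have hcov (a : ZFSet.{u}) (ha : a ∈ K) : {c : S.Cond | a ∈ c.top} ∈ 𝓓 :=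
    ⟨predense_covering hS ((hKM a).1 ha).2, hM.covering a ((hKM a).1 ha).1 ((hKM a).1 ha).2⟩
  have hmodels (c : S.Cond) (hc : e c ∈ M) (ξ : Ordinal.{u}) (hξ : ξ ≤ c.len) : c.f ξ ∈ K :=
    (hKM _).2 ⟨hM.models c hc ξ hξ, (c.good ξ hξ).mem_H⟩
  obtain ⟨D, hD⟩ := h𝓓.exists_eq_range ⟨_, hcov _ (hmodels c hc _ le_rfl)⟩
  have hDn (n : ℕ) : D n ∈ 𝓓 := hD ▸ ⟨n, rfl⟩
  have step (n : ℕ) (c : {c : S.Cond // e c ∈ M}) := by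
    exact hM.exists_step hS hK hKM c.2 (hDn n).1 (hDn n).2
  choose next hle hnM hlen hbelow hrefl using step
  let p : ℕ → {c : S.Cond // e c ∈ M} := fun n =>
    Nat.rec ⟨c, hc⟩ (fun n c => ⟨next n c, hnM n c⟩) n
  have hbelow' (n : ℕ) : ∃ d ∈ D n, e d ∈ M ∧ (p (n + 1) : S.Cond) ≤ d := hbelow n (p n)
  obtain ⟨q, hq⟩ := Cond.exists_limit (fun n => (p n).1) (fun n => hle n (p n))
    (fun n => hlen n (p n)) hK (fun n => hmodels _ (p n).2) (fun x hx => by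
      have := hcov x hx
      rw [hD] at this
      obtain ⟨n, hn⟩ := this
      obtain ⟨d, hd, -, h⟩ := hbelow' n
      rw [hn] at hd
      exact ⟨n + 1, Cond.top_subset_of_le h hd⟩) (fun n => hrefl n (p n))
  refine ⟨q, hq 0, fun r hr E hE hEM => ?_⟩
  have hE' : E ∈ 𝓓 := ⟨hE, hEM⟩
  rw [hD] at hE'
  obtain ⟨n, rfl⟩ := hE'
  obtain ⟨d, hd, hdM, h⟩ := hbelow' n
  -- The limit condition is below `d ∈ D n ∩ M` itself, so `r` is the common extension.
  exact ⟨d, hd, hdM, r, (hr.trans (hq (n + 1))).trans h, le_rfl⟩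

end OpenStationaryMap

/-! ### Skolem functions for suitability -/

theorem exists_injective_ZFSet (C : Type (u + 1)) [Small.{u} C] :
    ∃ e : C → ZFSet.{u}, Function.Injective e :=
  ⟨fun c => (Ordinal.typein (α := Shrink.{u} C) WellOrderingRel (equivShrink C c)).toZFSet,
    fun _ _ h => (equivShrink C).injective
      (Ordinal.typein_injective _ (Ordinal.toZFSet_injective h))⟩

open Classical in
/-- A binary function, as a unary function of ordered pairs. -/
noncomputable def onPair (G : ZFSet.{u} → ZFSet.{u} → ZFSet.{u}) (x : ZFSet.{u}) : ZFSet.{u} :=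
  if h : ∃ ab : ZFSet.{u} × ZFSet.{u}, x = ZFSet.pair ab.1 ab.2 then G h.choose.1 h.choose.2 else ∅

theorem onPair_pair (G : ZFSet.{u} → ZFSet.{u} → ZFSet.{u}) (a b : ZFSet.{u}) :
    onPair G (ZFSet.pair a b) = G a b := by
  have h : ∃ ab : ZFSet.{u} × ZFSet.{u}, ZFSet.pair a b = ZFSet.pair ab.1 ab.2 := ⟨(a, b), rfl⟩
  obtain ⟨h1, h2⟩ := ZFSet.pair_inj.1 h.choose_spec
  rw [onPair, dif_pos h, ← h1, ← h2]

open Classical in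
/-- A chosen element satisfying `p`, if there is one. -/
noncomputable def pick {α : Type*} (a : α) (p : α → Prop) : α := if h : ∃ x, p x then h.choose else a

theorem pick_spec {α : Type*} (a : α) {p : α → Prop} (h : ∃ x, p x) : p (pick a p) := by
  rw [pick, dif_pos h]
  exact h.choose_spec

/-- The `n`-th element of `Y` in a chosen enumeration. -/
noncomputable def enum (n : ℕ) (Y : ZFSet.{u}) : ZFSet.{u} :=
  pick (fun _ => ∅) (fun f : ℕ → ZFSet.{u} => (Y : Set ZFSet.{u}) = Set.range f) n

theorem exists_enum_eq {Y z : ZFSet.{u}} (hY : (Y : Set ZFSet.{u}).Countable) (hz : z ∈ Y) :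
    ∃ n, enum n Y = z := by
  have h := pick_spec (fun _ => ∅) (hY.exists_eq_range ⟨z, hz⟩)
  have hz' : z ∈ (Y : Set ZFSet.{u}) := hz
  rw [h] at hz'
  exact hz'

namespace OpenStationaryMap

variable {S : OpenStationaryMap.{u}}

theorem nonempty_cond (hS : IsClub (H S.θ) S.dom) : Nonempty S.Cond := by
  obtain ⟨K, hK, -⟩ := exists_good hS Set.countable_empty (by simp)
  obtain ⟨c, -⟩ := Cond.exists_of_good hK
  exact ⟨c⟩

/-- The subset of `C` coded by a set. -/
def decodeSet {C : Type (u + 1)} (e : C → ZFSet.{u}) (x : ZFSet.{u}) : Set C := {c | e c ∈ x}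

theorem decodeSet_codeSet {C : Type (u + 1)} [Small.{u} C] {e : C → ZFSet.{u}}
    (he : Function.Injective e) (D : Set C) : decodeSet e (codeSet e D) = D := by
  ext c
  rw [decodeSet, Set.mem_ofPred_eq, mem_codeSet]
  exact ⟨fun ⟨d, hd, h⟩ => he h ▸ hd, fun h => ⟨c, h, rfl⟩⟩

/-- A chosen condition `r` which reaches `x` within `Y`, with a chosen member of `D` above it. -/
noncomputable def Cond.reach (c : S.Cond) (D : Set S.Cond) (x : Set ZFSet.{u}) (Y : ZFSet.{u}) :
    S.Cond × S.Cond :=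
  pick (c, c) fun q => c.Reaches D x Y q.1 ∧ q.2 ∈ D ∧ q.1 ≤ q.2

theorem Cond.reach_spec {c : S.Cond} {D : Set S.Cond} {x : Set ZFSet.{u}} {Y : ZFSet.{u}}
    (h : ∃ r, c.Reaches D x Y r) : c.Reaches D x Y (c.reach D x Y).1 ∧
      (c.reach D x Y).2 ∈ D ∧ (c.reach D x Y).1 ≤ (c.reach D x Y).2 := by
  obtain ⟨r, hr⟩ := h
  obtain ⟨d, hd, h⟩ := hr.below
  exact pick_spec (c, c)
    (p := fun q : S.Cond × S.Cond => c.Reaches D x Y q.1 ∧ q.2 ∈ D ∧ q.1 ≤ q.2) ⟨(r, d), hr, hd, h⟩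

/-- The set of all models of a condition. -/
noncomputable def Cond.modelSet (c : S.Cond) : ZFSet.{u} :=
  ZFSet.range fun ξ : Set.Iic c.len => c.f ξ

/-- The functions under which a suitable model has to be closed. -/
noncomputable def closingFun [Nonempty S.Cond] (e : S.Cond → ZFSet.{u}) :
    ℕ ⊕ Fin 8 → ZFSet.{u} → ZFSet.{u}
  | .inl n => enum n
  | .inr 0 => fun _ => ∅
  | .inr 1 => onPair fun a x => insert a x
  | .inr 2 => onPair fun K a => pick ∅ fun L => S.IsGood L ∧ K ∈ L ∧ a ∈ L
  | .inr 3 => fun p => (Function.invFun e p).modelSet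
  | .inr 4 => fun a => codeSet e {c : S.Cond | a ∈ c.top}
  | .inr 5 => onPair fun p d => (Function.invFun e p).clubSet (decodeSet e d)
  -- The four arguments arrive as `((p, d), (x, Y))`.
  | .inr 6 => onPair fun q s => onPair (fun p d => onPair (fun x Y =>
      e ((Function.invFun e p).reach (decodeSet e d) (x : Set ZFSet.{u}) Y).1) s) q
  | .inr 7 => onPair fun q s => onPair (fun p d => onPair (fun x Y =>
      e ((Function.invFun e p).reach (decodeSet e d) (x : Set ZFSet.{u}) Y).2) s) q

/-- `W` contains every argument to which the closing functions are applied: elements of `H(θ)`,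
codes of conditions and of sets of conditions, and pairs of these. -/
theorem isSuitable_of_closed (hS : IsClub (H S.θ) S.dom) [Nonempty S.Cond]
    {e : S.Cond → ZFSet.{u}} (he : Function.Injective e) {W M : ZFSet.{u}} (hW : W.IsTransitive)
    (hWp : ∀ x ∈ W, ∀ y ∈ W, ZFSet.pair x y ∈ W) (hH : H S.θ ∈ W)
    (heW : (ZFSet.range e).powerset ∈ W) (hMc : (M : Set ZFSet.{u}).Countable)
    (hMp : ∀ a ∈ M, ∀ b ∈ M, ZFSet.pair a b ∈ M)
    (hM : ∀ i, ∀ a ∈ M, a ∈ W → closingFun e i a ∈ M) : IsSuitable e M := by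
  have hHW (x : ZFSet.{u}) (hx : x ∈ H S.θ) : x ∈ W := hW _ hH hx
  have hcode (D : Set S.Cond) : codeSet e D ∈ W :=
    hW _ heW (ZFSet.mem_powerset.2 fun x hx => (ZFSet.mem_sep.1 hx).1)
  have heW (c : S.Cond) : e c ∈ W := hW _ (hcode {c}) ((mem_codeSet e).2 ⟨c, rfl, rfl⟩)
  have hinv (c : S.Cond) : Function.invFun e (e c) = c := Function.leftInverse_invFun he c
  have hM2 (i : Fin 8) (a b : ZFSet.{u}) (ha : a ∈ M) (hb : b ∈ M) (haW : a ∈ W) (hbW : b ∈ W) :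
      closingFun e (.inr i) (ZFSet.pair a b) ∈ M :=
    hM (.inr i) _ (hMp a ha b hb) (hWp a haW b hbW)
  have hsub (Y : ZFSet.{u}) (hYM : Y ∈ M) (hY : Y ∈ ctbl (H S.θ)) : Y ⊆ M := by
    intro z hz
    obtain ⟨n, rfl⟩ := exists_enum_eq (mem_ctbl.1 hY).2 hz
    exact hM (.inl n) Y hYM (hHW _ (countable_mem_H hY))
  have hXctbl (Y : ZFSet.{u}) (hY : Y ∈ ctbl S.X) : Y ∈ ctbl (H S.θ) :=
    mem_ctbl.2 ⟨fun z hz => mem_H_of_mem_base ((mem_ctbl.1 hY).1 hz), (mem_ctbl.1 hY).2⟩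
  -- Finite subsets of `Y` enter `M` by inserting one element at a time; they are needed as
  -- arguments of `Cond.reach`.
  have hfin (Y : ZFSet.{u}) (hYM : Y ∈ M) (hY : Y ∈ ctbl (H S.θ)) (x : Set ZFSet.{u})
      (hx : x.Finite) (hxY : ∀ z ∈ x, z ∈ Y) :
      ∃ x' ∈ M, x' ∈ H S.θ ∧ (x' : Set ZFSet.{u}) = x := by
    have hYH := countable_mem_H hY
    induction x, hx using Set.Finite.induction_on with
    | empty =>
      refine ⟨∅, hM (.inr 0) Y hYM (hHW _ hYH), mem_H_of_subset hYH (ZFSet.empty_subset _), ?_⟩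
      ext z
      simp
    | @insert a s _ _ ih =>
      obtain ⟨x', hx'M, hx'H, rfl⟩ := ih fun z hz => hxY z (Set.mem_insert_of_mem _ hz)
      have ha := hxY a (Set.mem_insert _ _)
      have h := hM2 1 a x' (hsub Y hYM hY ha) hx'M (hHW _ (H_isTransitive _ _ hYH ha))
        (hHW _ hx'H)
      simp only [closingFun, onPair_pair] at h
      refine ⟨insert a x', h, mem_H_of_subset hYH fun z hz => ?_, ?_⟩
      · rcases ZFSet.mem_insert_iff.1 hz with rfl | hz
        exacts [ha, hxY z (Set.mem_insert_of_mem _ hz)]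
      · ext z
        simp
  refine ⟨hMc, hsub, fun K hK a ha hKg haH => ?_, fun c hc ξ hξ => ?_, fun a ha haH => ?_,
    fun c D hc hD => ?_, fun c D Y hY x hc hD hYE hx hxY => ?_⟩
  · have h := hM2 2 K a hK ha (hHW _ hKg.mem_H) (hHW _ haH)
    simp only [closingFun, onPair_pair] at h
    refine ⟨_, h, pick_spec ∅ (p := fun L => S.IsGood L ∧ K ∈ L ∧ a ∈ L) ?_⟩
    obtain ⟨L, hL, h⟩ := exists_good hS (s := {K, a}) (by simp) (by
      rintro y (rfl | rfl)
      exacts [hKg.mem_H, haH])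
    exact ⟨L, hL, h K (by simp), h a (by simp)⟩
  · have h := hM (.inr 3) _ hc (heW c)
    simp only [closingFun, hinv] at h
    refine hsub _ h (mem_ctbl.2 ⟨fun z hz => ?_, ?_⟩) (ZFSet.mem_range.2 ⟨⟨ξ, hξ⟩, rfl⟩)
    · obtain ⟨ζ, rfl⟩ := ZFSet.mem_range.1 hz
      exact (c.good _ ζ.2).mem_H
    · rw [Cond.modelSet, ZFSet.coe_range]
      have := (countable_Iic_of_lt_omega_one c.len_lt).to_subtype
      exact Set.countable_range _
  · exact hM (.inr 4) a ha (hHW _ haH)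
  · have h := hM2 5 _ _ hc hD (heW c) (hcode D)
    simpa only [closingFun, onPair_pair, hinv, decodeSet_codeSet he] using h
  · obtain ⟨hYX, hYE⟩ := ZFSet.mem_sep.1 hYE
    have hYH := hXctbl Y hYX
    obtain ⟨x', hx'M, hx'H, rfl⟩ := hfin Y hY hYH x hx hxY
    have hYW := hHW _ (countable_mem_H hYH)
    have hx'W := hHW _ hx'H
    have hspec := Cond.reach_spec (hYE _ hx hxY)
    have h1 := hM2 6 _ _ (hMp _ hc _ hD) (hMp _ hx'M _ hY) (hWp _ (heW c) _ (hcode D))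
      (hWp _ hx'W _ hYW)
    have h2 := hM2 7 _ _ (hMp _ hc _ hD) (hMp _ hx'M _ hY) (hWp _ (heW c) _ (hcode D))
      (hWp _ hx'W _ hYW)
    simp only [closingFun, onPair_pair, hinv, decodeSet_codeSet he] at h1 h2
    exact ⟨_, h1, hspec.1, _, hspec.2.1, h2, hspec.2.2⟩

/-! ### From a filter to a reflecting sequence -/

/-- A directed set of conditions whose models cover an uncountable set has conditions of every
countable length. -/
theorem exists_le_len {G : Set S.Cond} (hG : ∀ p ∈ G, ∀ q ∈ G, ∃ r ∈ G, r ≤ p ∧ r ≤ q)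
    {s : Set ZFSet.{u}} (hs : ¬ s.Countable) (hcov : ∀ x ∈ s, ∃ p ∈ G, x ∈ p.top)
    {ν : Ordinal.{u}} (hν : ν < ω₁) : ∃ p ∈ G, ν ≤ p.len := by
  by_contra! hlt
  -- By directedness, members of `G` of equal length have equal top models, so lengths bounded by
  -- `ν` would leave only countably many countable models to cover `s`.
  refine hs ((((countable_Iio_of_lt_omega_one hν).biUnion
    (t := fun ξ _ => {x | ∃ p ∈ G, p.len = ξ ∧ x ∈ p.top}) fun ξ _ => ?_)).mono fun x hx => ?_)
  · by_cases h : ∃ p ∈ G, p.len = ξ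
    · obtain ⟨p, hp, rfl⟩ := h
      refine p.top_good.countable.mono ?_
      rintro x ⟨q, hq, hl, hx⟩
      obtain ⟨r, -, hrp, hrq⟩ := hG p hp q hq
      have h1 := hrq.2 _ le_rfl
      rw [hl, hrp.2 _ le_rfl, ← hl] at h1
      rw [Cond.top, ← h1, hl] at hx
      exact hx
    · refine Set.countable_empty.mono ?_
      rintro x ⟨q, hq, hl, -⟩
      exact h ⟨q, hq, hl⟩
  · obtain ⟨p, hp, hx⟩ := hcov x hx
    simp only [Set.mem_iUnion]
    exact ⟨p.len, hlt p hp, p, hp, rfl, hx⟩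

/-- A directed set of conditions of all countable lengths yields a reflecting sequence. -/
theorem exists_reflecting_of_directed {G : Set S.Cond}
    (hG : ∀ p ∈ G, ∀ q ∈ G, ∃ r ∈ G, r ≤ p ∧ r ≤ q)
    (hlen : ∀ ν < ω₁, ∃ p ∈ G, ν ≤ p.len) :
    ∃ N : Ordinal.{u} → ZFSet.{u},
      (∀ ν < ω₁, N ν ∈ S.dom) ∧ IsContinuousChain N ∧ Reflects S N := by
  have hex (ν : Ordinal.{u}) : ∃ Y, ∀ p ∈ G, ν ≤ p.len → p.f ν = Y := by
    by_cases h : ∃ p ∈ G, ν ≤ p.len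
    · obtain ⟨p, hp, hν⟩ := h
      refine ⟨p.f ν, fun q hq hν' => ?_⟩
      obtain ⟨r, -, hrp, hrq⟩ := hG p hp q hq
      rw [← hrp.2 ν hν, ← hrq.2 ν hν']
    · exact ⟨∅, fun p hp hν => absurd ⟨p, hp, hν⟩ h⟩
  choose N hN using hex
  refine ⟨N, fun ν hν => ?_, ⟨fun ξ ν hξ hν => ?_, fun ν hν hl x => ?_⟩, fun ν hν hl => ?_⟩
  all_goals obtain ⟨p, hp, hpν⟩ := hlen ν hν
  · rw [← hN ν p hp hpν]
    exact (p.good ν hpν).1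
  · rw [← hN ν p hp hpν, ← hN ξ p hp (hξ.le.trans hpν)]
    exact p.mem ξ ν hξ hpν
  · rw [← hN ν p hp hpν]
    constructor
    · intro hx
      obtain ⟨ξ, hξ, hx⟩ := p.union ν hpν hl x hx
      exact ⟨ξ, hξ, by rwa [← hN ξ p hp (hξ.le.trans hpν)]⟩
    · rintro ⟨ξ, hξ, hx⟩
      rw [← hN ξ p hp (hξ.le.trans hpν)] at hx
      exact p.subset hξ.le hpν hx
  · obtain ⟨ν₀, hν₀, h⟩ := p.reflect ν hpν hl
    refine ⟨ν₀, hν₀, fun ξ h1 h2 => ?_⟩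
    rw [← hN ν p hp hpν, ← hN ξ p hp (h2.le.trans hpν)]
    exact h ξ h1 h2

end OpenStationaryMap

theorem PFA.mrp (pfa : PFA.{u}) : MRP.{u} := by
  intro S hS
  have := OpenStationaryMap.nonempty_cond hS
  obtain ⟨e, he⟩ := exists_injective_ZFSet S.Cond
  obtain ⟨W, hW, hHW, hWp⟩ :=
    exists_transitive_pair_closed (ZFSet.pair (H S.θ) (ZFSet.range e).powerset)
  obtain ⟨hHW, heW⟩ := pair_mem_transitive hW hHW
  have hcard : ℵ₁ ≤ #(S.X : Set ZFSet.{u}) := by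
    rw [← succ_aleph0, Order.succ_le_iff, ← not_le, Cardinal.le_aleph0_iff_set_countable]
    exact S.uncountable
  -- `X` may have more than ℵ₁ points, but only ℵ₁ dense sets can be met; covering ℵ₁ points is
  -- enough.
  obtain ⟨Z, hZX, hZ⟩ := Cardinal.le_mk_iff_exists_subset.1 hcard
  obtain ⟨G, -, hG, hGZ⟩ := pfa.exists_filter he (OpenStationaryMap.closingFun e) W
    (fun M hMc hMp hM c hc =>
      (OpenStationaryMap.isSuitable_of_closed hS he hW hWp hHW heW hMc hMp hM).exists_generic
        hS he hc) (κ := Z) hZ.le (fun z => {c | (z : ZFSet.{u}) ∈ c.top}) (fun z p => by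
      obtain ⟨d, hd, -, h⟩ := p.exists_extension hS (Set.countable_singleton (z : ZFSet.{u}))
        (by simpa using OpenStationaryMap.mem_H_of_mem_base (hZX z.2))
      exact ⟨d, hd, h _ rfl⟩)
  have hZc : ¬ Z.Countable := by
    rw [← Cardinal.le_aleph0_iff_set_countable, hZ, not_le]
    exact aleph0_lt_aleph_one
  exact OpenStationaryMap.exists_reflecting_of_directed hG fun ν hν =>
    OpenStationaryMap.exists_le_len hG hZc (fun z hz => hGZ ⟨z, hz⟩) hν

end MappingReflection

theorem theorem1 : MappingReflection.PFA.{u} → MappingReflection.MRP.{u} := by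
  exact MappingReflection.PFA.mrp
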